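/- Let $\mathbf{k}$ be a field of characteristic $0$, let $\otimes=\otimes_{\mathbf k}$, let $\tau$ be the flip $u\otimes v\mapsto v\otimes u$, and put $\partial^{\otimes^2}=\partial\otimes I+I\otimes\partial$ and $\partial^{\otimes^3}=\partial\otimes I\otimes I+I\otimes\partial\otimes I+I\otimes I\otimes\partial$. **Algebras.** Let $P$ be a $\mathbf{k}[\partial]$-module. A $\mathbf k$-bilinear map $P\times P\to P[\lambda]$, $(a,b)\mapsto a_\lambda b$, is sesquilinear if $(\partial a)_\lambda b=-\lambda\, a_\lambda b$ and $a_\lambda(\partial b)=(\partial+\lambda)a_\lambda b$. A Poisson conformal algebra $(P,[\cdot_\lambda\cdot],\cdot_\lambda\cdot)$ consists of two sesquilinear maps such that, for all $a,b,c\in P$: - $(P,[\cdot_\lambda\cdot])$ is a Lie conformal algebra: $[a_\lambda b]=-[b_{-\lambda-\partial}a]$ and $[a_\lambda[b_\mu c]]=[[a_\lambda b]_{\lambda+\mu}c]+[b_\mu[a_\lambda c]]$; - $(P,\cdot_\lambda\cdot)$ is a commutative associative conformal algebra: $(a_\lambda b)_{\lambda+\mu}c=a_\lambda(b_\mu c)$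 and $a_\lambda b=b_{-\lambda-\partial}a$; - $[a_\lambda(b_\mu c)]=[a_\lambda b]_{\lambda+\mu}c+b_\mu[a_\lambda c]$. Write $\mathfrak{ad}(a)_\lambda b=[a_\lambda b]$, $\mathfrak L(a)_\lambda b=a_\lambda b$ and $\mathfrak R(a)_\lambda b=b_{-\lambda-\partial}a$. **Coalgebras.** A Poisson conformal coalgebra $(P,\delta,\Delta)$ is a $\mathbf k[\partial]$-module $P$ with two $\mathbf k[\partial]$-module homomorphisms $\delta,\Delta:P\to P\otimes P$ (where $\partial$ acts on $P\otimes P$ by $\partial^{\otimes^2}$) such that: - $(P,\delta)$ is a Lie conformal coalgebra: $\delta=-\tau\delta$ and $(I\otimes\delta)\delta-(\tau\otimes I)(I\otimes\delta)\delta=(\delta\otimes I)\delta$; - $(P,\Delta)$ is a cocommutative associative conformal coalgebra: $\Delta=\tau\Delta$ and $(I\otimes\Delta)\Delta=(\Delta\otimes I)\Delta$; - $(I\otimes\Delta)\delta=(\delta\otimes I)\Delta+(\tau\otimes I)(I\otimes\delta)\Delta$. **Bialgebras.** A Poisson conformal bialgebra $(P,[\cdot_\lambda\cdot],\cdot_\lambda\cdot,\delta,\Delta)$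 is a Poisson conformal algebra that is also a Poisson conformal coalgebra $(P,\delta,\Delta)$ and satisfies, for all $a,b\in P$ and with $\nu=-\lambda-\partial^{\otimes^2}$, the following identities in $(P\otimes P)[\lambda]$. - Lie conformal bialgebra: $\delta([a_\lambda b])=(\mathfrak{ad}(a)_\lambda\otimes I+I\otimes\mathfrak{ad}(a)_\lambda)\delta(b)-(\mathfrak{ad}(b)_\nu\otimes I+I\otimes\mathfrak{ad}(b)_\nu)\delta(a)$. - Commutative and cocommutative antisymmetric infinitesimal conformal bialgebra: $\Delta(a_\lambda b)=(I\otimes\mathfrak L(a)_\lambda)\Delta(b)+(\mathfrak R(b)_\nu\otimes I)\Delta(a)$ and $(\mathfrak L(b)_\nu\otimes I-I\otimes\mathfrak R(b)_\nu)\Delta(a)+\tau(\mathfrak L(a)_\lambda\otimes I-I\otimes\mathfrak R(a)_\lambda)\Delta(b)=0$. - $\delta(a_\lambda b)=(\mathfrak L(a)_\lambda\otimes I)\delta(b)+(\mathfrak L(b)_\nu\otimes I)\delta(a)+(I\otimes\mathfrak{ad}(a)_\lambda)\Delta(b)+(I\otimes\mathfrak{ad}(b)_\nu)\Delta(a)$.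 - $\Delta([a_\lambda b])=(\mathfrak{ad}(a)_\lambda\otimes I+I\otimes\mathfrak{ad}(a)_\lambda)\Delta(b)-(I\otimes\mathfrak L(b)_\nu)\delta(a)+(\mathfrak L(b)_\nu\otimes I)\delta(a)$. **Statement.** Let $(P,[\cdot_\lambda\cdot],\cdot_\lambda\cdot)$ be a Poisson conformal algebra and let $r=\sum_i r_i\otimes l_i\in P\otimes P$ be skew-symmetric, that is, $\tau r=-r$. Put $$[[r,r]]=\sum_{i,j}\Big([{r_i}_\mu r_j]\otimes l_i\otimes l_j\big|_{\mu=I\otimes\partial\otimes I}-r_i\otimes[{r_j}_\mu l_i]\otimes l_j\big|_{\mu=I\otimes I\otimes\partial}-r_i\otimes r_j\otimes[{l_j}_\mu l_i]\big|_{\mu=I\otimes\partial\otimes I}\Big),$$ $$r\bullet r=\sum_{i,j}\Big(r_i\otimes r_j\otimes{l_i}_\mu l_j\big|_{\mu=\partial\otimes I\otimes I}-r_i\otimes{r_j}_\mu l_i\otimes l_j\big|_{\mu=-\partial^{\otimes^2}\otimes I}+{r_i}_\mu r_j\otimes l_i\otimes l_j\big|_{\mu=I\otimes\partial\otimes I}\Big).$$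 Suppose that $r$ satisfies the Poisson conformal Yang–Baxter equation: $[[r,r]]\equiv0$ and $r\bullet r\equiv0$ mod $(\partial^{\otimes^3})$, that is, both elements lie in $\partial^{\otimes^3}(P\otimes P\otimes P)$. Define, for $a\in P$, $$\delta(a)=(\mathfrak{ad}(a)_\lambda\otimes I+I\otimes\mathfrak{ad}(a)_\lambda)r\big|_{\lambda=-\partial^{\otimes^2}},\qquad \Delta(a)=(I\otimes\mathfrak L(a)_\lambda-\mathfrak L(a)_\lambda\otimes I)r\big|_{\lambda=-\partial^{\otimes^2}}.$$ Then $(P,\delta,\Delta)$ is a Poisson conformal coalgebra, and $(P,[\cdot_\lambda\cdot],\cdot_\lambda\cdot,\delta,\Delta)$ is a Poisson conformal bialgebra. -/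

import Mathlib

open scoped TensorProduct Polynomial

namespace PoissonConformal

noncomputable section

section Polynomials

variable {k V W : Type*} [Field k] [AddCommGroup V] [Module k V] [AddCommGroup W] [Module k W]

/-- `V[λ]`: polynomials in one formal variable with coefficients in `V`, encoded by the finitely
supported sequence of coefficients; `f n` is the coefficient of the `n`-th power. -/
abbrev LPoly (V : Type*) [AddCommGroup V] : Type _ := ℕ →₀ V

/-- The inclusion `V → V[λ]` of the constant polynomials. -/
def const : V →ₗ[k] LPoly V := Finsupp.lsingle 0

/-- Multiplication by the formal variable on `V[λ]`. -/
def var : Module.End k (LPoly V) := Finsupp.lmapDomain V k Nat.succ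

/-- A linear map applied to every coefficient, `V[λ] → W[λ]`. -/
def coeffMap (f : V →ₗ[k] W) : LPoly V →ₗ[k] LPoly W := Finsupp.mapRange.linearMap f

/-- Substitution of an operator for the formal variable: for `T : W → W` and a linear map
`i : V → W` that carries the coefficients to `W`, the polynomial `∑ λⁿ vₙ` is sent to
`∑ Tⁿ (i vₙ)`. -/
def subst (T : Module.End k W) (i : V →ₗ[k] W) : LPoly V →ₗ[k] W :=
  Finsupp.lsum k fun n => (T ^ n) ∘ₗ i

/-- `f ⊗ I`, sending `u ⊗ v` to `∑ λⁿ (fₙ(u) ⊗ v)` where `f(u) = ∑ λⁿ fₙ(u)`. -/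
def onLeft {U : Type*} [AddCommGroup U] [Module k U] (f : V →ₗ[k] LPoly W) :
    V ⊗[k] U →ₗ[k] LPoly (W ⊗[k] U) :=
  (TensorProduct.finsuppLeft k k W U ℕ).toLinearMap ∘ₗ f.rTensor U

/-- `I ⊗ f`, sending `u ⊗ v` to `∑ λⁿ (u ⊗ fₙ(v))` where `f(v) = ∑ λⁿ fₙ(v)`. -/
def onRight {U : Type*} [AddCommGroup U] [Module k U] (f : V →ₗ[k] LPoly W) :
    U ⊗[k] V →ₗ[k] LPoly (U ⊗[k] W) :=
  (TensorProduct.finsuppRight k k U W ℕ).toLinearMap ∘ₗ f.lTensor U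

end Polynomials

section Algebras

variable (k P : Type*) [Field k] [AddCommGroup P] [Module k P] [Module k[X] P]
  [IsScalarTower k k[X] P]

/-- The operator `∂` of a `k[∂]`-module `P`. -/
def del : Module.End k P := Algebra.lsmul k k P (Polynomial.X : k[X])

/-- `∂ ⊗ I + I ⊗ ∂` on `P ⊗ P`. -/
def del2 : Module.End k (P ⊗[k] P) := (del k P).rTensor P + (del k P).lTensor P

/-- `∂ ⊗ I ⊗ I` on `P ⊗ P ⊗ P`. -/
def delFst : Module.End k (P ⊗[k] (P ⊗[k] P)) := (del k P).rTensor (P ⊗[k] P)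

/-- `I ⊗ ∂ ⊗ I` on `P ⊗ P ⊗ P`. -/
def delSnd : Module.End k (P ⊗[k] (P ⊗[k] P)) := ((del k P).rTensor P).lTensor P

/-- `I ⊗ I ⊗ ∂` on `P ⊗ P ⊗ P`. -/
def delTrd : Module.End k (P ⊗[k] (P ⊗[k] P)) := ((del k P).lTensor P).lTensor P

/-- `∂ ⊗ I ⊗ I + I ⊗ ∂ ⊗ I + I ⊗ I ⊗ ∂` on `P ⊗ P ⊗ P`. -/
def del3 : Module.End k (P ⊗[k] (P ⊗[k] P)) := delFst k P + delSnd k P + delTrd k P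

/-- A `k`-bilinear map `P × P → P[λ]`, `(a, b) ↦ a_λ b`. -/
abbrev LambdaMap : Type _ := P →ₗ[k] P →ₗ[k] LPoly P

variable {k P}

/-- The operator `-λ - ∂` on `P[λ]`. -/
def negVarDel : Module.End k (LPoly P) := -var - coeffMap (del k P)

/-- The operator `-λ - (∂ ⊗ I + I ⊗ ∂)` on `(P ⊗ P)[λ]`. -/
def negVarDel2 : Module.End k (LPoly (P ⊗[k] P)) := -var - coeffMap (del2 k P)

/-- `opp m a b` is `b_{-λ-∂} a`, an element of `P[λ]`. -/
def opp (m : LambdaMap k P) : LambdaMap k P := m.flip.compr₂ (subst negVarDel const)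

/-- `mulAt m T i a b` is `a_T b`, pushed to `W` along `i : P → W`, with the operator `T` of `W`
in place of the formal variable. -/
def mulAt {W : Type*} [AddCommGroup W] [Module k W] (m : LambdaMap k P) (T : Module.End k W)
    (i : P →ₗ[k] W) : P →ₗ[k] P →ₗ[k] W := m.compr₂ (subst T i)

/-- `a_S (b_T c)` for the outer map `m` and the inner map `n`. -/
def nestRight {W : Type*} [AddCommGroup W] [Module k W] (i : P →ₗ[k] W)
    (m n : LambdaMap k P) (S T : Module.End k W) (a b c : P) : W :=
  subst T (mulAt m S i a) (n b c)

/-- `(a_S b)_T c` for the inner map `n` and the outer map `m`. -/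
def nestLeft {W : Type*} [AddCommGroup W] [Module k W] (i : P →ₗ[k] W)
    (n m : LambdaMap k P) (S T : Module.End k W) (a b c : P) : W :=
  subst S ((mulAt m T i).flip c) (n a b)

/-- The inclusion of `P` into `P[λ, μ] = P[λ][μ]`. -/
def const2 : P →ₗ[k] LPoly (LPoly P) := const ∘ₗ const

/-- Multiplication by the inner variable `λ` on `P[λ, μ] = P[λ][μ]`. -/
def lam : Module.End k (LPoly (LPoly P)) := coeffMap var

/-- Multiplication by the outer variable `μ` on `P[λ, μ] = P[λ][μ]`. -/
def mu : Module.End k (LPoly (LPoly P)) := var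

/-- Conformal sesquilinearity: `(∂a)_λ b = -λ a_λ b` and `a_λ (∂b) = (∂ + λ) a_λ b`. -/
structure IsSesquilinear (m : LambdaMap k P) : Prop where
  left : ∀ a b : P, m (del k P a) b = -var (k := k) (m a b)
  right : ∀ a b : P, m a (del k P b) = coeffMap (del k P) (m a b) + var (k := k) (m a b)

/-- Associative conformal algebra: `(a_λ b)_{λ+μ} c = a_λ (b_μ c)` in `P[λ, μ]`. -/
structure IsAssocConformalAlgebra (pr : LambdaMap k P) : Prop extends IsSesquilinear pr where
  assoc : ∀ a b c : P,
    nestLeft const2 pr pr lam (lam + mu) a b c = nestRight const2 pr pr lam mu a b c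

/-- Commutativity: `a_λ b = b_{-λ-∂} a`. -/
def IsCommutative (pr : LambdaMap k P) : Prop := ∀ a b : P, pr a b = opp pr a b

/-- Lie conformal algebra: sesquilinearity, `[a_λ b] = -[b_{-λ-∂} a]` and
`[a_λ [b_μ c]] = [[a_λ b]_{λ+μ} c] + [b_μ [a_λ c]]` in `P[λ, μ]`. -/
structure IsLieConformalAlgebra (br : LambdaMap k P) : Prop extends IsSesquilinear br where
  skew : ∀ a b : P, br a b = -opp br a b
  jacobi : ∀ a b c : P,
    nestRight const2 br br lam mu a b c =
      nestLeft const2 br br lam (lam + mu) a b c + nestRight const2 br br mu lam b a c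

/-- Poisson conformal algebra: a Lie conformal algebra and a commutative associative conformal
algebra with `[a_λ (b_μ c)] = [a_λ b]_{λ+μ} c + b_μ [a_λ c]` in `P[λ, μ]`. -/
structure IsPoissonConformalAlgebra (br pr : LambdaMap k P) : Prop where
  lie : IsLieConformalAlgebra br
  assoc : IsAssocConformalAlgebra pr
  comm : IsCommutative pr
  leibniz : ∀ a b c : P,
    nestRight const2 br pr lam mu a b c =
      nestLeft const2 br pr lam (lam + mu) a b c + nestRight const2 pr br mu lam b a c

end Algebras

section Coalgebras

variable {k P : Type*} [Field k] [AddCommGroup P] [Module k P] [Module k[X] P]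
  [IsScalarTower k k[X] P]

/-- The flip `τ` of `P ⊗ P`. -/
def flip : P ⊗[k] P →ₗ[k] P ⊗[k] P := (TensorProduct.comm k P P).toLinearMap

/-- `τ ⊗ I` on `P ⊗ P ⊗ P`. -/
def flip12 : P ⊗[k] (P ⊗[k] P) →ₗ[k] P ⊗[k] (P ⊗[k] P) :=
  (TensorProduct.leftComm k P P P).toLinearMap

/-- `I ⊗ D : P ⊗ P → P ⊗ P ⊗ P` for `D : P → P ⊗ P`. -/
def idTensor (D : P →ₗ[k] P ⊗[k] P) : P ⊗[k] P →ₗ[k] P ⊗[k] (P ⊗[k] P) := D.lTensor P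

/-- `D ⊗ I : P ⊗ P → P ⊗ P ⊗ P` for `D : P → P ⊗ P`. -/
def tensorId (D : P →ₗ[k] P ⊗[k] P) : P ⊗[k] P →ₗ[k] P ⊗[k] (P ⊗[k] P) :=
  (TensorProduct.assoc k P P P).toLinearMap ∘ₗ D.rTensor P

/-- `D : P → P ⊗ P` is a homomorphism of `k[∂]`-modules, where `∂` acts on `P ⊗ P` by
`∂ ⊗ I + I ⊗ ∂`. -/
def IsDelHom (D : P →ₗ[k] P ⊗[k] P) : Prop := ∀ a : P, D (del k P a) = del2 k P (D a)

/-- Associative conformal coalgebra. -/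
structure IsAssocConformalCoalgebra (D : P →ₗ[k] P ⊗[k] P) : Prop where
  hom : IsDelHom D
  coassoc : ∀ a : P, idTensor D (D a) = tensorId D (D a)

/-- Cocommutativity. -/
def IsCocommutative (D : P →ₗ[k] P ⊗[k] P) : Prop := ∀ a : P, D a = flip (D a)

/-- Lie conformal coalgebra. -/
structure IsLieConformalCoalgebra (d : P →ₗ[k] P ⊗[k] P) : Prop where
  hom : IsDelHom d
  skew : ∀ a : P, d a = -flip (d a)
  jacobi : ∀ a : P, idTensor d (d a) - flip12 (idTensor d (d a)) = tensorId d (d a)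

/-- Poisson conformal coalgebra `(P, δ, Δ)`. -/
structure IsPoissonConformalCoalgebra (d D : P →ₗ[k] P ⊗[k] P) : Prop where
  lie : IsLieConformalCoalgebra d
  assoc : IsAssocConformalCoalgebra D
  cocomm : IsCocommutative D
  compat : ∀ a : P, idTensor D (d a) = tensorId d (D a) + flip12 (idTensor d (D a))

/-- `(f_{-λ-∂^{⊗2}} ⊗ I)` applied to a tensor, in `(P ⊗ P)[λ]`. -/
def leftTw (f : P →ₗ[k] LPoly P) : P ⊗[k] P →ₗ[k] LPoly (P ⊗[k] P) :=
  subst negVarDel2 const ∘ₗ onLeft f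

/-- `(I ⊗ f_{-λ-∂^{⊗2}})` applied to a tensor, in `(P ⊗ P)[λ]`. -/
def rightTw (f : P →ₗ[k] LPoly P) : P ⊗[k] P →ₗ[k] LPoly (P ⊗[k] P) :=
  subst negVarDel2 const ∘ₗ onRight f

/-- Lie conformal bialgebra; `br a` is the adjoint map `b ↦ [a_λ b]`, and the compatibility is
an identity in `(P ⊗ P)[λ]`. -/
structure IsLieConformalBialgebra (br : LambdaMap k P) (d : P →ₗ[k] P ⊗[k] P) : Prop where
  algebra : IsLieConformalAlgebra br
  coalgebra : IsLieConformalCoalgebra d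
  compat : ∀ a b : P, coeffMap d (br a b) =
    (onLeft (br a) (d b) + onRight (br a) (d b)) - (leftTw (br b) (d a) + rightTw (br b) (d a))

/-- Antisymmetric infinitesimal conformal bialgebra. Here `pr a` is the left multiplication
`b ↦ a_λ b`, and `opp pr a` is the right multiplication `b ↦ b_{-λ-∂} a`. -/
structure IsASIConformalBialgebra (pr : LambdaMap k P) (D : P →ₗ[k] P ⊗[k] P) : Prop where
  algebra : IsAssocConformalAlgebra pr
  coalgebra : IsAssocConformalCoalgebra D
  compat : ∀ a b : P, coeffMap D (pr a b) = onRight (pr a) (D b) + leftTw (opp pr b) (D a)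
  antisymm : ∀ a b : P, (leftTw (pr b) (D a) - rightTw (opp pr b) (D a)) +
    coeffMap flip (onLeft (pr a) (D b) - onRight (opp pr a) (D b)) = 0

/-- Poisson conformal bialgebra `(P, [·_λ ·], ·_λ ·, δ, Δ)`. -/
structure IsPoissonConformalBialgebra (br pr : LambdaMap k P) (d D : P →ₗ[k] P ⊗[k] P) :
    Prop where
  algebra : IsPoissonConformalAlgebra br pr
  coalgebra : IsPoissonConformalCoalgebra d D
  lie : IsLieConformalBialgebra br d
  asi : IsASIConformalBialgebra pr D
  comm : IsCommutative pr
  cocomm : IsCocommutative D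
  compat_mul : ∀ a b : P, coeffMap d (pr a b) =
    onLeft (pr a) (d b) + leftTw (pr b) (d a) + onRight (br a) (D b) + rightTw (br b) (D a)
  compat_bracket : ∀ a b : P, coeffMap D (br a b) =
    (onLeft (br a) (D b) + onRight (br a) (D b)) - rightTw (pr b) (d a) + leftTw (pr b) (d a)

end Coalgebras

section Coboundary

variable {k P : Type*} [Field k] [AddCommGroup P] [Module k P] [Module k[X] P]
  [IsScalarTower k k[X] P]

/-- `(f_λ ⊗ I) r` at `λ = -∂^{⊗2}`, for `f = m a` and as a linear map in `a`. -/
def cobLeft (m : LambdaMap k P) (r : P ⊗[k] P) : P →ₗ[k] P ⊗[k] P where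
  toFun a := subst (-del2 k P) LinearMap.id (onLeft (m a) r)
  map_add' a b := by simp [onLeft, LinearMap.rTensor_add]
  map_smul' c a := by simp [onLeft, LinearMap.rTensor_smul]

/-- `(I ⊗ f_λ) r` at `λ = -∂^{⊗2}`, for `f = m a` and as a linear map in `a`. -/
def cobRight (m : LambdaMap k P) (r : P ⊗[k] P) : P →ₗ[k] P ⊗[k] P where
  toFun a := subst (-del2 k P) LinearMap.id (onRight (m a) r)
  map_add' a b := by simp [onRight, LinearMap.lTensor_add]
  map_smul' c a := by simp [onRight, LinearMap.lTensor_smul]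

/-- `δ(a) = (ad(a)_λ ⊗ I + I ⊗ ad(a)_λ) r` at `λ = -∂^{⊗2}`. -/
def cobDelta (br : LambdaMap k P) (r : P ⊗[k] P) : P →ₗ[k] P ⊗[k] P :=
  cobLeft br r + cobRight br r

/-- `Δ(a) = (I ⊗ L(a)_λ - L(a)_λ ⊗ I) r` at `λ = -∂^{⊗2}`. -/
def cobCoprod (pr : LambdaMap k P) (r : P ⊗[k] P) : P →ₗ[k] P ⊗[k] P :=
  cobRight pr r - cobLeft pr r

/-- `∑ᵢⱼ (rᵢ)_μ rⱼ ⊗ lᵢ ⊗ lⱼ` for `r = ∑ᵢ rᵢ ⊗ lᵢ`, with `T` in place of `μ`. -/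
def term1 (m : LambdaMap k P) (T : Module.End k (P ⊗[k] (P ⊗[k] P))) (r : P ⊗[k] P) :
    P ⊗[k] (P ⊗[k] P) :=
  subst T LinearMap.id (TensorProduct.finsuppLeft k k P (P ⊗[k] P) ℕ
    (TensorProduct.map₂ m (TensorProduct.mk k P P) r r))

/-- `∑ᵢⱼ rᵢ ⊗ (rⱼ)_μ lᵢ ⊗ lⱼ` for `r = ∑ᵢ rᵢ ⊗ lᵢ`, with `T` in place of `μ`. -/
def term2 (m : LambdaMap k P) (T : Module.End k (P ⊗[k] (P ⊗[k] P))) (r : P ⊗[k] P) :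
    P ⊗[k] (P ⊗[k] P) :=
  subst T LinearMap.id (onRight
    ((TensorProduct.finsuppLeft k k P P ℕ).toLinearMap ∘ₗ
      (LinearMap.rTensorHom P ∘ₗ m.flip).flip r) r)

/-- `∑ᵢⱼ rᵢ ⊗ rⱼ ⊗ (lᵢ)_μ lⱼ` for `r = ∑ᵢ rᵢ ⊗ lᵢ`, with `T` in place of `μ`. -/
def term3 (m : LambdaMap k P) (T : Module.End k (P ⊗[k] (P ⊗[k] P))) (r : P ⊗[k] P) :
    P ⊗[k] (P ⊗[k] P) :=
  subst T (TensorProduct.assoc k P P P).toLinearMap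
    (TensorProduct.finsuppRight k k (P ⊗[k] P) P ℕ
      (TensorProduct.map₂ (TensorProduct.mk k P P) m r r))

/-- `[[r, r]]`: for `r = ∑ᵢ rᵢ ⊗ lᵢ`, the sum over `i, j` of
`[(rᵢ)_μ rⱼ] ⊗ lᵢ ⊗ lⱼ` at `μ = I ⊗ ∂ ⊗ I`, minus `rᵢ ⊗ [(rⱼ)_μ lᵢ] ⊗ lⱼ` at `μ = I ⊗ I ⊗ ∂`,
minus `rᵢ ⊗ rⱼ ⊗ [(lⱼ)_μ lᵢ]` at `μ = I ⊗ ∂ ⊗ I`. -/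
def doubleBracket (br : LambdaMap k P) (r : P ⊗[k] P) : P ⊗[k] (P ⊗[k] P) :=
  term1 br (delSnd k P) r - term2 br (delTrd k P) r - term3 br.flip (delSnd k P) r

/-- `r • r`: for `r = ∑ᵢ rᵢ ⊗ lᵢ`, the sum over `i, j` of
`rᵢ ⊗ rⱼ ⊗ (lᵢ)_μ lⱼ` at `μ = ∂ ⊗ I ⊗ I`, minus `rᵢ ⊗ (rⱼ)_μ lᵢ ⊗ lⱼ` at
`μ = -∂^{⊗2} ⊗ I`, plus `(rᵢ)_μ rⱼ ⊗ lᵢ ⊗ lⱼ` at `μ = I ⊗ ∂ ⊗ I`. -/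
def bullet (pr : LambdaMap k P) (r : P ⊗[k] P) : P ⊗[k] (P ⊗[k] P) :=
  term3 pr (delFst k P) r - term2 pr (-(delFst k P + delSnd k P)) r + term1 pr (delSnd k P) r

/-- `x ≡ 0 mod (∂^{⊗3})`: `x` lies in `∂^{⊗3} (P ⊗ P ⊗ P)`. -/
def IsZeroModDel3 (x : P ⊗[k] (P ⊗[k] P)) : Prop := x ∈ LinearMap.range (del3 k P)

/-- The Poisson conformal Yang-Baxter equation for `r`. -/
structure IsPCYBESolution (br pr : LambdaMap k P) (r : P ⊗[k] P) : Prop where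
  bracket : IsZeroModDel3 (doubleBracket br r)
  product : IsZeroModDel3 (bullet pr r)

end Coboundary

end

end PoissonConformal

/-! Let `a` act on one factor of P ⊗ P ⊗ P by the bracket or the product at λ = -∂^{⊗3} (`act1`,
`act2`, `act3`). Sesquilinearity turns ∂ on that factor into ∂ + λ, so ∂^{⊗3} turns into ∂^{⊗3} + λ
= 0. These actions therefore kill ∂^{⊗3}(P ⊗ P ⊗ P) (`act1_eq_zero` and its analogues), which is why
the Yang–Baxter equation is only needed modulo ∂^{⊗3}.

Split δ and Δ into the halves `cobLeft` and `cobRight`. A composite such as (I ⊗ δ)δ(a) then has two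
kinds of terms: two operations in different factors (`sep`), or `a` combined with an entry of r and
the result combined with a second entry in the same factor (`nestLeft`). An action on a term of
[[r,r]] or r • r that misses its product gives the first kind, up to skew-symmetry or commutativity.
One that hits the product gives a nested expression, which Jacobi, associativity or Leibniz rewrites
into the second kind. Matching all terms expresses each coalgebra defect through actions on elements
that are zero mod ∂^{⊗3}: co-Jacobi: act1 + act2 + act3 by the bracket on [[r,r]]; coassociativity:
act3 - act1 by the product on r • r; compatibility: act1 by the bracket on r • r, plus act3 - act2
by the product on [[r,r]].

The bialgebra identities need no further use of the Yang–Baxter equation. Since λ + ν = -∂^{⊗2} is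
the point at which δ and Δ are evaluated, the terms with `a` and `b` in the same factor obey the
algebra axioms at (λ, ν). The terms with `a` and `b` in different factors are identified in pairs by
`onLeft_cobRight` and `onRight_cobLeft`.

Throughout, commuting operators are substituted for the formal variables (`jacobi_at`, `assoc_at`,
`leibniz_at`). On tensors they are integral combinations `op3` or `op2` of the basic operators, so
checking a substitution is arithmetic with three integers. -/

namespace PoissonConformal

noncomputable section

/-! ### Substitution of operators for a formal variable -/

section Substitution

variable {k V W X : Type*} [Field k] [AddCommGroup V] [Module k V] [AddCommGroup W] [Module k W]
  [AddCommGroup X] [Module k X]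

lemma subst_single (T : Module.End k W) (i : V →ₗ[k] W) (n : ℕ) (v : V) :
    subst T i (Finsupp.single n v) = (T ^ n) (i v) := by
  simp [subst]

lemma subst_const (T : Module.End k W) (i : V →ₗ[k] W) (v : V) :
    subst T i (const (k := k) v) = i v := by
  simp [const, subst_single]

lemma subst_var (T : Module.End k W) (i : V →ₗ[k] W) (f : LPoly V) :
    subst T i (var (k := k) f) = T (subst T i f) := by
  induction f using Finsupp.induction_linear with
  | zero => simp
  | add f g hf hg => simp only [map_add, hf, hg]
  | single n v =>
    rw [var, Finsupp.lmapDomain_apply, Finsupp.mapDomain_single, subst_single, subst_single,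
      Nat.succ_eq_add_one, pow_succ', Module.End.mul_apply]

lemma subst_coeffMap (T : Module.End k W) (i : X →ₗ[k] W) (g : V →ₗ[k] X) (f : LPoly V) :
    subst T i (coeffMap g f) = subst T (i ∘ₗ g) f := by
  induction f using Finsupp.induction_linear with
  | zero => simp
  | add f g hf hg => simp only [map_add, hf, hg]
  | single n v => simp [coeffMap, subst_single]

lemma subst_congr (T : Module.End k W) {i j : V →ₗ[k] W} (h : ∀ v, i v = j v) (f : LPoly V) :
    subst T i f = subst T j f := by
  rw [LinearMap.ext h]

/-- A linear map that intertwines two operators commutes with the substitution of them. -/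
lemma map_subst {T : Module.End k W} {T' : Module.End k X} (G : W →ₗ[k] X)
    (h : ∀ w, G (T w) = T' (G w)) (i : V →ₗ[k] W) (f : LPoly V) :
    G (subst T i f) = subst T' (G ∘ₗ i) f := by
  induction f using Finsupp.induction_linear with
  | zero => simp
  | add f g hf hg => simp only [map_add, hf, hg]
  | single n v =>
    rw [subst_single, subst_single, LinearMap.comp_apply]
    generalize i v = w
    induction n with
    | zero => rfl
    | succ n ih => rw [pow_succ', pow_succ', Module.End.mul_apply, Module.End.mul_apply, h, ih]

lemma subst_add (T : Module.End k W) (i j : V →ₗ[k] W) (f : LPoly V) :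
    subst T (i + j) f = subst T i f + subst T j f := by
  induction f using Finsupp.induction_linear with
  | zero => simp
  | add f g hf hg => simp only [map_add, hf, hg]; abel
  | single n v => simp [subst_single]

lemma subst_smul (T : Module.End k W) (c : k) (i : V →ₗ[k] W) (f : LPoly V) :
    subst T (c • i) f = c • subst T i f := by
  induction f using Finsupp.induction_linear with
  | zero => simp
  | add f g hf hg => simp only [map_add, hf, hg, smul_add]
  | single n v => simp [subst_single]

/-- Substitution, as a linear map of the coefficient map. -/
def substHom (T : Module.End k W) : (V →ₗ[k] W) →ₗ[k] LPoly V →ₗ[k] W where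
  toFun i := subst T i
  map_add' i j := LinearMap.ext (subst_add T i j)
  map_smul' c i := LinearMap.ext (subst_smul T c i)

lemma substHom_apply (T : Module.End k W) (i : V →ₗ[k] W) : substHom T i = subst T i := rfl

lemma subst_sum {ι : Type*} (s : Finset ι) (T : Module.End k W) (i : ι → V →ₗ[k] W)
    (f : LPoly V) : subst T (∑ n ∈ s, i n) f = ∑ n ∈ s, subst T (i n) f := by
  simp only [← substHom_apply, map_sum, LinearMap.sum_apply]

lemma subst_neg (T : Module.End k W) (i : V →ₗ[k] W) (f : LPoly V) :
    subst T (-i) f = -subst T i f := by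
  simp only [← substHom_apply, map_neg, LinearMap.neg_apply]

/-- An operator commuting with the substituted one can be taken out of the coefficients. -/
lemma subst_coeff_comm {T E : Module.End k W} (h : Commute T E) (i : V →ₗ[k] W) (f : LPoly V) :
    subst T (E ∘ₗ i) f = E (subst T i f) :=
  (map_subst E (fun w => LinearMap.congr_fun h.eq.symm w) i f).symm

lemma subst_var_const (f : LPoly V) : subst (var (k := k)) (const (k := k)) f = f := by
  induction f using Finsupp.induction_linear with
  | zero => simp
  | add f g hf hg => simp only [map_add, hf, hg]
  | single n v =>
    rw [subst_single]
    induction n with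
    | zero => rfl
    | succ n ih =>
      rw [pow_succ', Module.End.mul_apply, ih]
      simp [var, Finsupp.mapDomain_single]

/-- Fubini for the double sum of Sᵐ Tⁿ j(fₘ, gₙ); commutation of S and T makes the order of the
powers irrelevant. -/
lemma subst_comm {V' : Type*} [AddCommGroup V'] [Module k V'] {S T : Module.End k W}
    (h : Commute S T) (j : V →ₗ[k] V' →ₗ[k] W) (f : LPoly V) (g : LPoly V') :
    subst S ((substHom T).flip g ∘ₗ j) f = subst T ((substHom S).flip f ∘ₗ j.flip) g := by
  induction f using Finsupp.induction_linear with
  | zero =>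
    simp only [map_zero, LinearMap.zero_comp]
    simp [← substHom_apply]
  | add f f' hf hf' => simp only [map_add, hf, hf', LinearMap.add_comp, subst_add]
  | single n v =>
    rw [subst_single, LinearMap.comp_apply, LinearMap.flip_apply, substHom_apply]
    rw [← subst_coeff_comm ((h.pow_left n).symm)]
    congr 1
    ext q
    simp [substHom_apply, subst_single]

end Substitution

/-! ### Conformal identities evaluated at commuting operators -/

section Products

variable {k P W : Type*} [Field k] [AddCommGroup P] [Module k P] [AddCommGroup W] [Module k W]

lemma mulAt_apply (m : LambdaMap k P) (T : Module.End k W) (i : P →ₗ[k] W) (a b : P) :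
    mulAt m T i a b = subst T i (m a b) := rfl

lemma mulAt_congr (m : LambdaMap k P) {T T' : Module.End k W} {i i' : P →ₗ[k] W} (hT : T = T')
    (h : ∀ p, i p = i' p) (a b : P) : mulAt m T i a b = mulAt m T' i' a b := by
  rw [hT, LinearMap.ext h]

lemma map_mulAt {X : Type*} [AddCommGroup X] [Module k X] (m : LambdaMap k P)
    {T : Module.End k W} {T' : Module.End k X} (G : W →ₗ[k] X)
    (h : ∀ w, G (T w) = T' (G w)) (i : P →ₗ[k] W) (a b : P) :
    G (mulAt m T i a b) = mulAt m T' (G ∘ₗ i) a b := map_subst G h i _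

/-- `j (a_S b, c_T d)` for a bilinear map `j : P × P → W`, with `S` and `T` operators of `W`. -/
def sep (j : P →ₗ[k] P →ₗ[k] W) (m n : LambdaMap k P) (S T : Module.End k W) (a b c d : P) : W :=
  mulAt m S ((substHom T).flip (n c d) ∘ₗ j) a b

lemma sep_comm {S T : Module.End k W} (h : Commute S T) (j : P →ₗ[k] P →ₗ[k] W)
    (m n : LambdaMap k P) (a b c d : P) :
    sep j m n S T a b c d = sep j.flip n m T S c d a b := subst_comm h j _ _

/-- The inner variable λ produces powers of S standing to the right of the powers of T, so S has to
be moved past T. The outer variable μ needs no such commutation. -/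
lemma subst_lam {S T : Module.End k W} (h : Commute S T) (i : P →ₗ[k] W) (f : LPoly (LPoly P)) :
    subst T (subst S i) (lam (k := k) f) = S (subst T (subst S i) f) := by
  rw [lam, subst_coeffMap, ← subst_coeff_comm h.symm]
  exact subst_congr _ (fun f => subst_var S i f) _

lemma subst_mu (S T : Module.End k W) (i : P →ₗ[k] W) (f : LPoly (LPoly P)) :
    subst T (subst S i) (mu (k := k) f) = T (subst T (subst S i) f) := subst_var T _ f

/-- Together with its two companions below, this transfers axioms stated in P[λ, μ] to any commuting
pair of operators on any target of a placement. -/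
lemma subst_nestRight (m n : LambdaMap k P) {S T : Module.End k W} (h : Commute S T)
    (i : P →ₗ[k] W) (a b c : P) :
    subst T (subst S i) (nestRight const2 m n lam mu a b c) =
      nestRight i m n S T a b c := by
  change _ = mulAt n T (mulAt m S i a) b c
  rw [nestRight, map_subst (T' := T) _ (subst_mu S T i)]
  refine subst_congr _ (fun p => ?_) _
  rw [LinearMap.comp_apply, map_mulAt (T' := S) m _ (subst_lam h i)]
  exact mulAt_congr _ rfl (fun q => by simp [const2, subst_const]) _ _

lemma subst_nestRight' (m n : LambdaMap k P) {S T : Module.End k W} (h : Commute S T)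
    (i : P →ₗ[k] W) (a b c : P) :
    subst T (subst S i) (nestRight const2 m n mu lam a b c) =
      nestRight i m n T S a b c := by
  change _ = mulAt n S (mulAt m T i a) b c
  rw [nestRight, map_subst (T' := S) _ (subst_lam h i)]
  refine subst_congr _ (fun p => ?_) _
  rw [LinearMap.comp_apply, map_mulAt (T' := T) m _ (subst_mu S T i)]
  exact mulAt_congr _ rfl (fun q => by simp [const2, subst_const]) _ _

lemma subst_nestLeft (n m : LambdaMap k P) {S T : Module.End k W} (h : Commute S T)
    (i : P →ₗ[k] W) (a b c : P) :
    subst T (subst S i) (nestLeft const2 n m lam (lam + mu) a b c) =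
      nestLeft i n m S (S + T) a b c := by
  change _ = mulAt n S ((mulAt m (S + T) i).flip c) a b
  rw [nestLeft, map_subst (T' := S) _ (subst_lam h i)]
  refine subst_congr _ (fun p => ?_) _
  rw [LinearMap.comp_apply, LinearMap.flip_apply, LinearMap.flip_apply,
    map_mulAt (T' := S + T) m]
  · exact mulAt_congr _ rfl (fun q => by simp [const2, subst_const]) _ _
  · intro f
    rw [LinearMap.add_apply, map_add, subst_lam h]
    congr 1
    exact subst_mu S T i f

variable [Module k[X] P] [IsScalarTower k k[X] P]

/-- The placement intertwines ∂ with E, so the substitution λ ↦ T sends -λ - ∂ to -T - E; T and E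
must commute for ∂ to leave the coefficients. -/
lemma mulAt_opp (m : LambdaMap k P) {T E : Module.End k W} {i : P →ₗ[k] W}
    (hi : ∀ p, i (del k P p) = E (i p)) (h : Commute T E) (a b : P) :
    mulAt (opp m) T i a b = mulAt m (-T - E) i b a := by
  have hi' : i ∘ₗ del k P = E ∘ₗ i := LinearMap.ext hi
  change subst T i (subst negVarDel const (m b a)) = subst (-T - E) i (m b a)
  rw [map_subst (T' := -T - E)]
  · exact subst_congr _ (fun p => subst_const T i p) _
  · intro f
    simp only [negVarDel, LinearMap.sub_apply, LinearMap.neg_apply, map_sub, map_neg, subst_var,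
      subst_coeffMap, hi', subst_coeff_comm h]

lemma mulAt_skew {br : LambdaMap k P} (hbr : ∀ a b, br a b = -opp br a b)
    {T E : Module.End k W} {i : P →ₗ[k] W}
    (hi : ∀ p, i (del k P p) = E (i p)) (h : Commute T E) (a b : P) :
    mulAt br T i a b = -mulAt br (-T - E) i b a := by
  rw [← mulAt_opp br hi h, mulAt_apply, hbr, map_neg, ← mulAt_apply]

lemma mulAt_comm {pr : LambdaMap k P} (hpr : IsCommutative pr)
    {T E : Module.End k W} {i : P →ₗ[k] W}
    (hi : ∀ p, i (del k P p) = E (i p)) (h : Commute T E) (a b : P) :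
    mulAt pr T i a b = mulAt pr (-T - E) i b a := by
  rw [← mulAt_opp pr hi h, mulAt_apply, hpr, ← mulAt_apply]

lemma mulAt_del_left {m : LambdaMap k P} (hm : IsSesquilinear m) (T : Module.End k W)
    (i : P →ₗ[k] W) (a b : P) : mulAt m T i (del k P a) b = -T (mulAt m T i a b) := by
  rw [mulAt_apply, hm.left, map_neg, subst_var, mulAt_apply]

lemma mulAt_del_right {m : LambdaMap k P} (hm : IsSesquilinear m) {T E : Module.End k W}
    {i : P →ₗ[k] W} (hi : ∀ p, i (del k P p) = E (i p)) (h : Commute T E) (a b : P) :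
    mulAt m T i a (del k P b) = (E + T) (mulAt m T i a b) := by
  have hi' : i ∘ₗ del k P = E ∘ₗ i := LinearMap.ext hi
  rw [mulAt_apply, hm.right, map_add, subst_var, mulAt_apply, subst_coeffMap, hi',
    subst_coeff_comm h, LinearMap.add_apply]

lemma sep_skew_right {br : LambdaMap k P} (hbr : ∀ a b, br a b = -opp br a b)
    (m : LambdaMap k P) {S T E : Module.End k W} {j : P →ₗ[k] P →ₗ[k] W}
    (hj : ∀ p q, j p (del k P q) = E (j p q)) (h : Commute T E) (a b c d : P) :
    sep j m br S T a b c d = -sep j m br S (-T - E) a b d c := by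
  rw [sep, sep, mulAt_apply, mulAt_apply, ← subst_neg]
  refine subst_congr _ (fun p => ?_) _
  exact mulAt_skew hbr (hj p) h c d

lemma sep_comm_right {pr : LambdaMap k P} (hpr : IsCommutative pr)
    (m : LambdaMap k P) {S T E : Module.End k W} {j : P →ₗ[k] P →ₗ[k] W}
    (hj : ∀ p q, j p (del k P q) = E (j p q)) (h : Commute T E) (a b c d : P) :
    sep j m pr S T a b c d = sep j m pr S (-T - E) a b d c := by
  rw [sep, sep, mulAt_apply, mulAt_apply]
  refine subst_congr _ (fun p => ?_) _
  exact mulAt_comm hpr (hj p) h c d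

section Nested

variable {br pr m n : LambdaMap k P} {S T E : Module.End k W} {i : P →ₗ[k] W}

/-- By right sesquilinearity the placement p ↦ a_S p carries ∂ to E + S, which takes the role of E
in `mulAt_skew`. -/
lemma nestRight_skew (hm : IsSesquilinear m) (hbr : ∀ a b, br a b = -opp br a b)
    (hi : ∀ p, i (del k P p) = E (i p)) (hST : Commute S T) (hS : Commute S E)
    (hT : Commute T E) (a b c : P) :
    nestRight i m br S T a b c = -nestRight i m br S (-T - (E + S)) a c b :=
  mulAt_skew hbr (mulAt_del_right hm hi hS a) (hT.add_right hST.symm) b c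

/-- By left sesquilinearity the placement p ↦ p_T c carries ∂ to -T, so -S - ∂ becomes T - S. -/
lemma nestLeft_skew (hm : IsSesquilinear m) (hbr : ∀ a b, br a b = -opp br a b)
    (hST : Commute S T) (a b c : P) :
    nestLeft i br m S T a b c = -nestLeft i br m (T - S) T b a c := by
  have h := mulAt_skew hbr (i := (mulAt m T i).flip c) (E := -T)
    (fun p => mulAt_del_left hm T i p c) hST.neg_right a b
  rw [show -S - -T = T - S by abel] at h
  exact h

lemma nestLeft_comm (hm : IsSesquilinear m) (hpr : IsCommutative pr)
    (hST : Commute S T) (a b c : P) :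
    nestLeft i pr m S T a b c = nestLeft i pr m (T - S) T b a c := by
  have h := mulAt_comm hpr (i := (mulAt m T i).flip c) (E := -T)
    (fun p => mulAt_del_left hm T i p c) hST.neg_right a b
  rw [show -S - -T = T - S by abel] at h
  exact h

lemma nestLeft_skew_outer (hbr : ∀ a b, br a b = -opp br a b)
    (hi : ∀ p, i (del k P p) = E (i p)) (hT : Commute T E) (a b c : P) :
    nestLeft i n br S T a b c = -nestRight i br n (-T - E) S c a b := by
  change subst S _ _ = -subst S _ _
  rw [← subst_neg]
  exact subst_congr _ (fun p => mulAt_skew hbr hi hT p c) _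

lemma nestLeft_comm_outer (hpr : IsCommutative pr)
    (hi : ∀ p, i (del k P p) = E (i p)) (hT : Commute T E) (a b c : P) :
    nestLeft i n pr S T a b c = nestRight i pr n (-T - E) S c a b :=
  subst_congr _ (fun p => mulAt_comm hpr hi hT p c) _

variable (i)

/-- `[a_S [b_T c]] = [[a_S b]_{S+T} c] + [b_T [a_S c]]`. -/
lemma jacobi_at (hP : IsLieConformalAlgebra br) (h : Commute S T) (a b c : P) :
    nestRight i br br S T a b c =
      nestLeft i br br S (S + T) a b c + nestRight i br br T S b a c := by
  rw [← subst_nestRight br br h, hP.jacobi, map_add, subst_nestLeft br br h,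
    subst_nestRight' br br h]

/-- `(a_S b)_{S+T} c = a_S (b_T c)`. -/
lemma assoc_at (hP : IsAssocConformalAlgebra pr) (h : Commute S T) (a b c : P) :
    nestLeft i pr pr S (S + T) a b c = nestRight i pr pr S T a b c := by
  rw [← subst_nestRight pr pr h, ← hP.assoc, subst_nestLeft pr pr h]

/-- `[a_S (b_T c)] = [a_S b]_{S+T} c + b_T [a_S c]`. -/
lemma leibniz_at (hP : IsPoissonConformalAlgebra br pr) (h : Commute S T) (a b c : P) :
    nestRight i br pr S T a b c =
      nestLeft i br pr S (S + T) a b c + nestRight i pr br T S b a c := by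
  rw [← subst_nestRight br pr h, hP.leibniz, map_add, subst_nestLeft br pr h,
    subst_nestRight' pr br h]

/-- `a_S (b_T c) = b_T (a_S c)`. -/
lemma mul_left_comm_at (hP : IsAssocConformalAlgebra pr) (hc : IsCommutative pr)
    (h : Commute S T) (a b c : P) :
    nestRight i pr pr S T a b c = nestRight i pr pr T S b a c := by
  rw [← assoc_at i hP h, ← assoc_at i hP h.symm,
    nestLeft_comm hP.toIsSesquilinear hc ((Commute.refl S).add_right h), add_sub_cancel_left,
    add_comm T S]

variable {i}

/-- `[(a_S b)_{S+T} c] = a_S [b_T c] + b_T [a_S c]`. -/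
lemma leibniz_left_at (hP : IsPoissonConformalAlgebra br pr)
    (hi : ∀ p, i (del k P p) = E (i p)) (h : Commute S T) (hS : Commute S E) (hT : Commute T E)
    (a b c : P) :
    nestLeft i pr br S (S + T) a b c =
      nestRight i pr br S T a b c + nestRight i pr br T S b a c := by
  -- Moving c to the outside on the left evaluates it at -(S + T) - E. Leibniz applies there, and
  -- skew-symmetry and commutativity then bring c back to the right.
  have hV : ∀ {X : Module.End k W}, Commute S X → Commute T X → Commute E X →
      Commute (-(S + T) - E) X := fun h1 h2 h3 => ((h1.add_left h2).neg_left).sub_left h3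
  have hVS := hV (Commute.refl S) h.symm hS.symm
  have hVT := hV h (Commute.refl T) hT.symm
  have hVE := hV hS hT (Commute.refl E)
  rw [nestLeft_skew_outer hP.lie.skew hi (hS.add_left hT), leibniz_at i hP hVS,
    nestLeft_comm_outer hP.comm hi (hVE.add_left hS),
    nestRight_skew (T := -(S + T) - E) hP.assoc.toIsSesquilinear hP.lie.skew hi hVS.symm hS hVE,
    show -(-(S + T) - E + S) - E = T by abel,
    nestRight_skew (T := -(S + T) - E) hP.assoc.toIsSesquilinear hP.lie.skew hi hVT.symm hT hVE,
    show -(-(S + T) - E) - (E + S) = T by abel, show -(-(S + T) - E) - (E + T) = S by abel]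
  abel

end Nested

end Products

universe u

/-! ### Pure tensors and a skew-symmetric presentation of r -/

section Tensors

variable {k P W X : Type*} [Field k] [AddCommGroup P] [Module k P] [AddCommGroup W] [Module k W]
  [AddCommGroup X] [Module k X]

lemma mulAt_sum {ι : Type*} (s : Finset ι) (m : LambdaMap k P) (T : Module.End k W)
    (i : ι → P →ₗ[k] W) (a b : P) :
    mulAt m T (∑ n ∈ s, i n) a b = ∑ n ∈ s, mulAt m T (i n) a b := subst_sum s T i _

lemma mulAt_neg (m : LambdaMap k P) (T : Module.End k W) (i : P →ₗ[k] W) (a b : P) :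
    mulAt m T (-i) a b = -mulAt m T i a b := subst_neg T i _

lemma map_sep (G : W →ₗ[k] X) {S T : Module.End k W} {S' T' : Module.End k X}
    (hS : ∀ w, G (S w) = S' (G w)) (hT : ∀ w, G (T w) = T' (G w))
    (j : P →ₗ[k] P →ₗ[k] W) (m n : LambdaMap k P) (a b c d : P) :
    G (sep j m n S T a b c d) = sep (j.compr₂ G) m n S' T' a b c d := by
  rw [sep, map_mulAt m G hS]
  exact mulAt_congr m rfl (fun p => map_subst G hT (j p) _) _ _

lemma onLeft_tmul (f : P →ₗ[k] LPoly W) (u : P) (v : X) :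
    onLeft f (u ⊗ₜ[k] v) = coeffMap ((TensorProduct.mk k W X).flip v) (f u) := by
  ext n
  simp [onLeft, coeffMap, TensorProduct.finsuppLeft_apply_tmul_apply]

lemma onRight_tmul (f : P →ₗ[k] LPoly W) (u : X) (v : P) :
    onRight f (u ⊗ₜ[k] v) = coeffMap (TensorProduct.mk k X W u) (f v) := by
  ext n
  simp [onRight, coeffMap, TensorProduct.finsuppRight_apply_tmul_apply]

/-- A skew-symmetric tensor is a sum of pure tensors, in an order-four symmetric presentation. -/
lemma exists_skew_presentation {k : Type*} {P : Type u} [Field k] [AddCommGroup P] [Module k P]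
    [CharZero k] (r : P ⊗[k] P) (hr : flip r = -r) :
    ∃ (ι : Type u) (_ : Fintype ι) (σ : Equiv.Perm ι) (x y : ι → P),
      r = ∑ i, x i ⊗ₜ[k] y i ∧ (∀ i, x (σ i) = y i) ∧ ∀ i, y (σ i) = -x i := by
  obtain ⟨s, hs⟩ := TensorProduct.exists_finset r
  -- Each u ⊗ v contributes the orbit of (u, cv) under (x, y) ↦ (y, -x), with sum 2c(u ⊗ v - v ⊗ u).
  -- Over all pairs this totals 2c(r - τr) = 4c r, whence c = 1/4. Reindexing by σ later plays the
  -- role of skew-symmetry of r.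
  let c : k := 1 / 4
  refine ⟨s × Fin 4, inferInstance, (Equiv.refl _).prodCongr (Equiv.addRight 1),
    fun i => (![i.1.1.1, c • i.1.1.2, -i.1.1.1, -(c • i.1.1.2)] : Fin 4 → P) i.2,
    fun i => (![c • i.1.1.2, -i.1.1.1, -(c • i.1.1.2), i.1.1.1] : Fin 4 → P) i.2, ?_, ?_, ?_⟩
  · have h4 : ∀ f : s × Fin 4 → P ⊗[k] P, ∑ i, f i = ∑ p : s, ∑ n : Fin 4, f (p, n) :=
      fun f => Fintype.sum_prod_type f
    rw [h4]
    have hp : ∀ p : s, ∑ n : Fin 4,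
        (![p.1.1, c • p.1.2, -p.1.1, -(c • p.1.2)] : Fin 4 → P) n ⊗ₜ[k]
          (![c • p.1.2, -p.1.1, -(c • p.1.2), p.1.1] : Fin 4 → P) n =
        (2 * c) • (p.1.1 ⊗ₜ[k] p.1.2 - p.1.2 ⊗ₜ[k] p.1.1) := by
      intro p
      simp [Fin.sum_univ_four, TensorProduct.neg_tmul, TensorProduct.tmul_neg,
        ← TensorProduct.smul_tmul', TensorProduct.tmul_smul]
      module
    rw [Finset.sum_congr rfl fun p _ => hp p, ← Finset.smul_sum, Finset.sum_sub_distrib]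
    have h1 : ∑ p : s, p.1.1 ⊗ₜ[k] p.1.2 = r := by
      rw [hs]; exact Finset.sum_coe_sort s fun p => p.1 ⊗ₜ[k] p.2
    have h2 : ∑ p : s, p.1.2 ⊗ₜ[k] p.1.1 = -r := by
      rw [← hr, ← h1, map_sum]; rfl
    rw [h1, h2]
    have : (2 * c) * 2 = 1 := by norm_num [c]
    rw [sub_neg_eq_add, ← two_smul k r, smul_smul, this, one_smul]
  · rintro ⟨p, n⟩
    fin_cases n <;> rfl
  · rintro ⟨p, n⟩
    fin_cases n <;> simp

/-- An integral linear combination of three operators. -/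
def combo (A B C : Module.End k W) (α β γ : ℤ) : Module.End k W := α • A + β • B + γ • C

lemma combo_commute {A B C : Module.End k W} (hAB : Commute A B) (hAC : Commute A C)
    (hBC : Commute B C) (α β γ α' β' γ' : ℤ) :
    Commute (combo A B C α β γ) (combo A B C α' β' γ') := by
  have h : ∀ E : Module.End k W, Commute A E → Commute B E → Commute C E →
      Commute (combo A B C α β γ) E := fun E h1 h2 h3 =>
    ((h1.smul_left α).add_left (h2.smul_left β)).add_left (h3.smul_left γ)
  have h' : ∀ E : Module.End k W, Commute E A → Commute E B → Commute E C →
      Commute E (combo A B C α' β' γ') := fun E h1 h2 h3 =>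
    ((h1.smul_right α').add_right (h2.smul_right β')).add_right (h3.smul_right γ')
  exact h _ (h' _ (Commute.refl A) hAB hAC) (h' _ hAB.symm (Commute.refl B) hBC)
    (h' _ hAC.symm hBC.symm (Commute.refl C))

end Tensors

/-! ### Placements in the threefold tensor product and the operators `op3` -/

section Slots

variable {k P : Type*} [Field k] [AddCommGroup P] [Module k P]

/-- The placement `p ↦ p ⊗ v ⊗ w`. -/
def slot1 (v w : P) : P →ₗ[k] P ⊗[k] (P ⊗[k] P) := (TensorProduct.mk k P _).flip (v ⊗ₜ w)

/-- The placement `p ↦ u ⊗ p ⊗ w`. -/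
def slot2 (u w : P) : P →ₗ[k] P ⊗[k] (P ⊗[k] P) :=
  TensorProduct.mk k P _ u ∘ₗ (TensorProduct.mk k P P).flip w

/-- The placement `p ↦ u ⊗ v ⊗ p`. -/
def slot3 (u v : P) : P →ₗ[k] P ⊗[k] (P ⊗[k] P) :=
  TensorProduct.mk k P _ u ∘ₗ TensorProduct.mk k P P v

/-- The placement `(p, q) ↦ p ⊗ q ⊗ w`. -/
def pair12 (w : P) : P →ₗ[k] P →ₗ[k] P ⊗[k] (P ⊗[k] P) :=
  (TensorProduct.mk k P (P ⊗[k] P)).compl₂ ((TensorProduct.mk k P P).flip w)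

/-- The placement `(p, q) ↦ p ⊗ v ⊗ q`. -/
def pair13 (v : P) : P →ₗ[k] P →ₗ[k] P ⊗[k] (P ⊗[k] P) :=
  (TensorProduct.mk k P (P ⊗[k] P)).compl₂ (TensorProduct.mk k P P v)

/-- The placement `(p, q) ↦ u ⊗ p ⊗ q`. -/
def pair23 (u : P) : P →ₗ[k] P →ₗ[k] P ⊗[k] (P ⊗[k] P) :=
  (TensorProduct.mk k P P).compr₂ (TensorProduct.mk k P (P ⊗[k] P) u)

@[simp] lemma slot1_apply (v w p : P) : slot1 (k := k) v w p = p ⊗ₜ (v ⊗ₜ w) := rfl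
@[simp] lemma slot2_apply (u w p : P) : slot2 (k := k) u w p = u ⊗ₜ (p ⊗ₜ w) := rfl
@[simp] lemma slot3_apply (u v p : P) : slot3 (k := k) u v p = u ⊗ₜ (v ⊗ₜ p) := rfl
@[simp] lemma pair12_apply (w p q : P) : pair12 (k := k) w p q = p ⊗ₜ (q ⊗ₜ w) := rfl
@[simp] lemma pair13_apply (v p q : P) : pair13 (k := k) v p q = p ⊗ₜ (v ⊗ₜ q) := rfl
@[simp] lemma pair23_apply (u p q : P) : pair23 (k := k) u p q = u ⊗ₜ (p ⊗ₜ q) := rfl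

lemma end_tensor_ext {W : Type*} [AddCommGroup W] [Module k W]
    {f g : P ⊗[k] (P ⊗[k] P) →ₗ[k] W}
    (h : ∀ u v w : P, f (u ⊗ₜ (v ⊗ₜ w)) = g (u ⊗ₜ (v ⊗ₜ w))) : f = g := by
  ext u v w
  exact h u v w

variable [Module k[X] P] [IsScalarTower k k[X] P]

lemma delFst_commute_delSnd : Commute (delFst k P) (delSnd k P) :=
  end_tensor_ext fun _ _ _ => rfl

lemma delFst_commute_delTrd : Commute (delFst k P) (delTrd k P) :=
  end_tensor_ext fun _ _ _ => rfl

lemma delSnd_commute_delTrd : Commute (delSnd k P) (delTrd k P) :=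
  end_tensor_ext fun _ _ _ => rfl

variable (k P) in
/-- The operator `α ∂ ⊗ I ⊗ I + β I ⊗ ∂ ⊗ I + γ I ⊗ I ⊗ ∂` on `P ⊗ P ⊗ P`. -/
def op3 (α β γ : ℤ) : Module.End k (P ⊗[k] (P ⊗[k] P)) :=
  combo (delFst k P) (delSnd k P) (delTrd k P) α β γ

lemma op3_commute (α β γ α' β' γ' : ℤ) : Commute (op3 k P α β γ) (op3 k P α' β' γ') :=
  combo_commute delFst_commute_delSnd delFst_commute_delTrd delSnd_commute_delTrd _ _ _ _ _ _

lemma delFst_eq : delFst k P = op3 k P 1 0 0 := by simp [op3, combo]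

lemma delSnd_eq : delSnd k P = op3 k P 0 1 0 := by simp [op3, combo]

lemma delTrd_eq : delTrd k P = op3 k P 0 0 1 := by simp [op3, combo]

lemma op3_add (α β γ α' β' γ' : ℤ) :
    op3 k P α β γ + op3 k P α' β' γ' = op3 k P (α + α') (β + β') (γ + γ') := by
  simp only [op3, combo]; module

lemma op3_neg (α β γ : ℤ) : -op3 k P α β γ = op3 k P (-α) (-β) (-γ) := by
  simp only [op3, combo]; module

lemma op3_sub (α β γ α' β' γ' : ℤ) :
    op3 k P α β γ - op3 k P α' β' γ' = op3 k P (α - α') (β - β') (γ - γ') := by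
  simp only [op3, combo]; module

lemma op3_tmul (α β γ : ℤ) (u v w : P) : op3 k P α β γ (u ⊗ₜ (v ⊗ₜ w)) =
    α • (del k P u ⊗ₜ (v ⊗ₜ w)) + β • (u ⊗ₜ (del k P v ⊗ₜ w)) + γ • (u ⊗ₜ (v ⊗ₜ del k P w)) :=
  rfl

lemma del3_eq : del3 k P = op3 k P 1 1 1 := by simp [op3, combo, del3]

end Slots

section Auxiliary

variable {k P : Type*} [Field k] [AddCommGroup P] [Module k P] {ι : Type*} [Fintype ι]

lemma flip_flip (w : P ⊗[k] P) : flip (flip w) = w := (TensorProduct.comm k P P).symm_apply_apply w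

/-- A product is additive in its placement. -/
lemma mulAt_eq_sum {W : Type*} [AddCommGroup W] [Module k W] (n : LambdaMap k P)
    (S : Module.End k W) {i : P →ₗ[k] W} {j : ι → P →ₗ[k] W} (h : ∀ p, i p = ∑ l, j l p) (a b : P) :
    mulAt n S i a b = ∑ l, mulAt n S (j l) a b := by
  rw [← mulAt_sum]
  exact mulAt_congr n rfl (fun p => by rw [h, LinearMap.sum_apply]) a b

/-- The map `v ⊗ w ↦ v ⊗ w ⊗ u`. -/
def tensorRight (u : P) : P ⊗[k] P →ₗ[k] P ⊗[k] (P ⊗[k] P) :=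
  (TensorProduct.assoc k P P P).toLinearMap ∘ₗ (TensorProduct.mk k (P ⊗[k] P) P).flip u

@[simp] lemma tensorRight_tmul (u v w : P) :
    tensorRight (k := k) u (v ⊗ₜ w) = v ⊗ₜ (w ⊗ₜ u) := rfl

end Auxiliary

/-! ### The two halves of the coboundary maps -/

section Coboundary

variable {k P W : Type*} [Field k] [AddCommGroup P] [Module k P] [AddCommGroup W] [Module k W]
  [Module k[X] P] [IsScalarTower k k[X] P] {ι : Type*} [Fintype ι] {x y : ι → P} {r : P ⊗[k] P}

lemma map_cobLeft (hr : r = ∑ i, x i ⊗ₜ[k] y i) (m : LambdaMap k P) (G : P ⊗[k] P →ₗ[k] W)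
    {T : Module.End k W} (hG : ∀ w, G (-del2 k P w) = T (G w)) (a : P) :
    G (cobLeft m r a) = ∑ i, mulAt m T (G ∘ₗ (TensorProduct.mk k P P).flip (y i)) a (x i) := by
  change G (subst (-del2 k P) LinearMap.id (onLeft (m a) r)) = _
  rw [hr, map_sum, map_sum, map_sum]
  refine Finset.sum_congr rfl fun i _ => ?_
  rw [onLeft_tmul, subst_coeffMap, map_subst G hG]
  rfl

lemma map_cobRight (hr : r = ∑ i, x i ⊗ₜ[k] y i) (m : LambdaMap k P) (G : P ⊗[k] P →ₗ[k] W)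
    {T : Module.End k W} (hG : ∀ w, G (-del2 k P w) = T (G w)) (a : P) :
    G (cobRight m r a) = ∑ i, mulAt m T (G ∘ₗ TensorProduct.mk k P P (x i)) a (y i) := by
  change G (subst (-del2 k P) LinearMap.id (onRight (m a) r)) = _
  rw [hr, map_sum, map_sum, map_sum]
  refine Finset.sum_congr rfl fun i _ => ?_
  rw [onRight_tmul, subst_coeffMap, map_subst G hG]
  rfl

lemma del2_tmul (u v : P) : del2 k P (u ⊗ₜ v) = del k P u ⊗ₜ v + u ⊗ₜ del k P v := rfl

/-- Left sesquilinearity gives a factor -λ, and the evaluation point λ = -∂^{⊗2} turns it into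
∂^{⊗2}. -/
lemma cobLeft_del {m : LambdaMap k P} (hm : IsSesquilinear m) (r : P ⊗[k] P) :
    IsDelHom (cobLeft m r) := by
  intro a
  induction r with
  | zero => simp [cobLeft]
  | add r s hr hs =>
    have h : ∀ b, cobLeft m (r + s) b = cobLeft m r b + cobLeft m s b :=
      fun b => map_add (subst (-del2 k P) LinearMap.id ∘ₗ onLeft (m b)) r s
    rw [h, h, hr, hs, map_add]
  | tmul u v =>
    change subst (-del2 k P) LinearMap.id (onLeft (m (del k P a)) (u ⊗ₜ v)) =
      del2 k P (subst (-del2 k P) LinearMap.id (onLeft (m a) (u ⊗ₜ v)))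
    rw [onLeft_tmul, onLeft_tmul, subst_coeffMap, subst_coeffMap, hm.left, map_neg, subst_var]
    simp

lemma cobRight_del {m : LambdaMap k P} (hm : IsSesquilinear m) (r : P ⊗[k] P) :
    IsDelHom (cobRight m r) := by
  intro a
  induction r with
  | zero => simp [cobRight]
  | add r s hr hs =>
    have h : ∀ b, cobRight m (r + s) b = cobRight m r b + cobRight m s b :=
      fun b => map_add (subst (-del2 k P) LinearMap.id ∘ₗ onRight (m b)) r s
    rw [h, h, hr, hs, map_add]
  | tmul u v =>
    change subst (-del2 k P) LinearMap.id (onRight (m (del k P a)) (u ⊗ₜ v)) =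
      del2 k P (subst (-del2 k P) LinearMap.id (onRight (m a) (u ⊗ₜ v)))
    rw [onRight_tmul, onRight_tmul, subst_coeffMap, subst_coeffMap, hm.left, map_neg, subst_var]
    simp

lemma flip_del2 (w : P ⊗[k] P) : flip (del2 k P w) = del2 k P (flip w) := by
  induction w with
  | zero => simp
  | add u v hu hv => simp only [map_add, hu, hv]
  | tmul u v => simp [flip, del2_tmul, add_comm]

lemma flip_cobLeft (m : LambdaMap k P) (r : P ⊗[k] P) (a : P) :
    flip (cobLeft m r a) = cobRight m (flip r) a := by
  change flip (subst (-del2 k P) LinearMap.id (onLeft (m a) r)) =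
    subst (-del2 k P) LinearMap.id (onRight (m a) (flip r))
  induction r with
  | zero => simp
  | add u v hu hv => simp only [map_add, hu, hv]
  | tmul u v =>
    rw [map_subst (T' := -del2 k P) flip (fun w => by simp [flip_del2])]
    change _ = subst (-del2 k P) LinearMap.id (onRight (m a) (v ⊗ₜ u))
    rw [onLeft_tmul, onRight_tmul, subst_coeffMap, subst_coeffMap]
    rfl

lemma flip_cobRight (m : LambdaMap k P) (r : P ⊗[k] P) (a : P) :
    flip (cobRight m r a) = cobLeft m (flip r) a := by
  rw [← flip_flip (cobLeft m (flip r) a), flip_cobLeft, flip_flip]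

lemma cobLeft_neg (m : LambdaMap k P) (r : P ⊗[k] P) (a : P) :
    cobLeft m (-r) a = -cobLeft m r a :=
  map_neg (subst (-del2 k P) LinearMap.id ∘ₗ onLeft (m a)) r

lemma cobRight_neg (m : LambdaMap k P) (r : P ⊗[k] P) (a : P) :
    cobRight m (-r) a = -cobRight m r a :=
  map_neg (subst (-del2 k P) LinearMap.id ∘ₗ onRight (m a)) r

end Coboundary

/-! ### Composites of two coboundary maps in P ⊗ P ⊗ P -/

section Triple

variable {k P : Type*} [Field k] [AddCommGroup P] [Module k P]
  [Module k[X] P] [IsScalarTower k k[X] P] {ι : Type*} [Fintype ι] {x y : ι → P} {r : P ⊗[k] P}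

/-- The evaluation point -∂^{⊗2} of the map applied first becomes -∂^{⊗3} after the second one. The
second map is itself evaluated at minus the sum of ∂ over the two factors it creates, as in
`mk_del2` and `tensorRight_del2`. -/
lemma idTensor_del2 {D : P →ₗ[k] P ⊗[k] P} (hD : IsDelHom D) (w : P ⊗[k] P) :
    idTensor D (-del2 k P w) = op3 k P (-1) (-1) (-1) (idTensor D w) := by
  induction w with
  | zero => simp
  | add u v hu hv => simp only [map_add, neg_add, hu, hv]
  | tmul u v =>
    simp only [idTensor, del2_tmul, map_neg, map_add, LinearMap.lTensor_tmul, hD v]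
    generalize D v = w
    induction w with
    | zero => simp
    | add p q hp hq =>
      simp only [map_add, TensorProduct.tmul_add, neg_add] at *
      rw [← hp, ← hq]
      abel
    | tmul p q => rw [op3_tmul, del2_tmul, TensorProduct.tmul_add]; module

lemma tensorId_del2 {D : P →ₗ[k] P ⊗[k] P} (hD : IsDelHom D) (w : P ⊗[k] P) :
    tensorId D (-del2 k P w) = op3 k P (-1) (-1) (-1) (tensorId D w) := by
  induction w with
  | zero => simp
  | add u v hu hv => simp only [map_add, neg_add, hu, hv]
  | tmul u v =>
    simp only [tensorId, del2_tmul, map_neg, map_add, LinearMap.comp_apply,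
      LinearMap.rTensor_tmul, hD u]
    generalize D u = w
    induction w with
    | zero => simp
    | add p q hp hq =>
      simp only [map_add, TensorProduct.add_tmul, neg_add] at *
      rw [← hp, ← hq]
      abel
    | tmul p q =>
      simp only [del2_tmul, TensorProduct.add_tmul, map_add, LinearEquiv.coe_coe,
        TensorProduct.assoc_tmul, op3_tmul]
      module

lemma mk_del2 (u : P) (w : P ⊗[k] P) : TensorProduct.mk k P (P ⊗[k] P) u (-del2 k P w) =
    op3 k P 0 (-1) (-1) (TensorProduct.mk k P (P ⊗[k] P) u w) := by
  induction w with
  | zero => simp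
  | add u v hu hv => simp only [map_add, neg_add, hu, hv]
  | tmul p q =>
    simp only [TensorProduct.mk_apply, del2_tmul, op3_tmul, TensorProduct.tmul_neg,
      TensorProduct.tmul_add]
    module

lemma tensorRight_del2 (u : P) (w : P ⊗[k] P) : tensorRight u (-del2 k P w) =
    op3 k P (-1) (-1) 0 (tensorRight u w) := by
  induction w with
  | zero => simp
  | add u v hu hv => simp only [map_add, neg_add, hu, hv]
  | tmul p q =>
    simp only [del2_tmul, op3_tmul, map_neg, map_add, tensorRight_tmul]
    module

variable {m n : LambdaMap k P}

/-- In this and the following expansions, the last word of the name is the side on which `a` acts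
first. If that factor is not the one split afterwards, the two operations stay in separate factors;
otherwise they nest. -/
lemma idTensor_left_left (hr : r = ∑ i, x i ⊗ₜ[k] y i) (hm : IsSesquilinear m) (a : P) :
    idTensor (cobLeft m r) (cobLeft n r a) = ∑ i, ∑ j, sep (pair12 (y j)) n m
      (op3 k P (-1) (-1) (-1)) (op3 k P 0 (-1) (-1)) a (x i) (y i) (x j) := by
  rw [map_cobLeft hr n _ (idTensor_del2 (cobLeft_del hm r))]
  exact Finset.sum_congr rfl fun i _ => mulAt_eq_sum n _
    (fun p => map_cobLeft hr m (TensorProduct.mk k P (P ⊗[k] P) p) (mk_del2 p) (y i)) a (x i)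

lemma idTensor_right_left (hr : r = ∑ i, x i ⊗ₜ[k] y i) (hm : IsSesquilinear m) (a : P) :
    idTensor (cobRight m r) (cobLeft n r a) = ∑ i, ∑ j, sep (pair13 (x j)) n m
      (op3 k P (-1) (-1) (-1)) (op3 k P 0 (-1) (-1)) a (x i) (y i) (y j) := by
  rw [map_cobLeft hr n _ (idTensor_del2 (cobRight_del hm r))]
  exact Finset.sum_congr rfl fun i _ => mulAt_eq_sum n _
    (fun p => map_cobRight hr m (TensorProduct.mk k P (P ⊗[k] P) p) (mk_del2 p) (y i)) a (x i)

lemma idTensor_left_right (hr : r = ∑ i, x i ⊗ₜ[k] y i) (hm : IsSesquilinear m) (a : P) :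
    idTensor (cobLeft m r) (cobRight n r a) = ∑ i, ∑ j, nestLeft (slot2 (x i) (y j)) n m
      (op3 k P (-1) (-1) (-1)) (op3 k P 0 (-1) (-1)) a (y i) (x j) := by
  rw [map_cobRight hr n _ (idTensor_del2 (cobLeft_del hm r))]
  exact Finset.sum_congr rfl fun i _ => mulAt_eq_sum n _
    (fun p => map_cobLeft hr m (TensorProduct.mk k P (P ⊗[k] P) (x i)) (mk_del2 _) p) a (y i)

lemma idTensor_right_right (hr : r = ∑ i, x i ⊗ₜ[k] y i) (hm : IsSesquilinear m) (a : P) :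
    idTensor (cobRight m r) (cobRight n r a) = ∑ i, ∑ j, nestLeft (slot3 (x i) (x j)) n m
      (op3 k P (-1) (-1) (-1)) (op3 k P 0 (-1) (-1)) a (y i) (y j) := by
  rw [map_cobRight hr n _ (idTensor_del2 (cobRight_del hm r))]
  exact Finset.sum_congr rfl fun i _ => mulAt_eq_sum n _
    (fun p => map_cobRight hr m (TensorProduct.mk k P (P ⊗[k] P) (x i)) (mk_del2 _) p) a (y i)

lemma tensorId_left_left (hr : r = ∑ i, x i ⊗ₜ[k] y i) (hm : IsSesquilinear m) (a : P) :
    tensorId (cobLeft m r) (cobLeft n r a) = ∑ i, ∑ j, nestLeft (slot1 (y j) (y i)) n m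
      (op3 k P (-1) (-1) (-1)) (op3 k P (-1) (-1) 0) a (x i) (x j) := by
  rw [map_cobLeft hr n _ (tensorId_del2 (cobLeft_del hm r))]
  exact Finset.sum_congr rfl fun i _ => mulAt_eq_sum n _
    (fun p => map_cobLeft hr m (tensorRight (y i)) (tensorRight_del2 _) p) a (x i)

lemma tensorId_right_left (hr : r = ∑ i, x i ⊗ₜ[k] y i) (hm : IsSesquilinear m) (a : P) :
    tensorId (cobRight m r) (cobLeft n r a) = ∑ i, ∑ j, nestLeft (slot2 (x j) (y i)) n m
      (op3 k P (-1) (-1) (-1)) (op3 k P (-1) (-1) 0) a (x i) (y j) := by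
  rw [map_cobLeft hr n _ (tensorId_del2 (cobRight_del hm r))]
  exact Finset.sum_congr rfl fun i _ => mulAt_eq_sum n _
    (fun p => map_cobRight hr m (tensorRight (y i)) (tensorRight_del2 _) p) a (x i)

lemma tensorId_left_right (hr : r = ∑ i, x i ⊗ₜ[k] y i) (hm : IsSesquilinear m) (a : P) :
    tensorId (cobLeft m r) (cobRight n r a) = ∑ i, ∑ j, sep (pair13 (y j)).flip n m
      (op3 k P (-1) (-1) (-1)) (op3 k P (-1) (-1) 0) a (y i) (x i) (x j) := by
  rw [map_cobRight hr n _ (tensorId_del2 (cobLeft_del hm r))]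
  exact Finset.sum_congr rfl fun i _ => mulAt_eq_sum n _
    (fun p => map_cobLeft hr m (tensorRight p) (tensorRight_del2 _) (x i)) a (y i)

lemma tensorId_right_right (hr : r = ∑ i, x i ⊗ₜ[k] y i) (hm : IsSesquilinear m) (a : P) :
    tensorId (cobRight m r) (cobRight n r a) = ∑ i, ∑ j, sep (pair23 (x j)).flip n m
      (op3 k P (-1) (-1) (-1)) (op3 k P (-1) (-1) 0) a (y i) (x i) (y j) := by
  rw [map_cobRight hr n _ (tensorId_del2 (cobRight_del hm r))]
  exact Finset.sum_congr rfl fun i _ => mulAt_eq_sum n _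
    (fun p => map_cobRight hr m (tensorRight p) (tensorRight_del2 _) (x i)) a (y i)

lemma flip12_op3 (α β γ : ℤ) (w : P ⊗[k] (P ⊗[k] P)) :
    flip12 (op3 k P α β γ w) = op3 k P β α γ (flip12 w) := by
  have h : flip12 ∘ₗ op3 k P α β γ = op3 k P β α γ ∘ₗ flip12 := end_tensor_ext fun u v w => by
    simp only [LinearMap.comp_apply, op3_tmul, map_add, map_zsmul, flip12, LinearEquiv.coe_coe,
      TensorProduct.leftComm_tmul]
    module
  exact LinearMap.congr_fun h w

lemma flip12_nestLeft (i : P →ₗ[k] P ⊗[k] (P ⊗[k] P)) (α β γ α' β' γ' : ℤ) (a b c : P) :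
    flip12 (nestLeft i n m (op3 k P α β γ) (op3 k P α' β' γ') a b c) =
      nestLeft (flip12 ∘ₗ i) n m (op3 k P β α γ) (op3 k P β' α' γ') a b c := by
  rw [nestLeft, map_subst flip12 (flip12_op3 _ _ _)]
  exact subst_congr _ (fun p => map_mulAt m flip12 (flip12_op3 _ _ _) i p c) _

lemma flip12_left_left (hr : r = ∑ i, x i ⊗ₜ[k] y i) (hm : IsSesquilinear m) (a : P) :
    flip12 (idTensor (cobLeft m r) (cobLeft n r a)) = ∑ i, ∑ j, sep (pair12 (y j)).flip n m
      (op3 k P (-1) (-1) (-1)) (op3 k P (-1) 0 (-1)) a (x i) (y i) (x j) := by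
  simp only [idTensor_left_left hr hm, map_sum,
    map_sep flip12 (flip12_op3 _ _ _) (flip12_op3 _ _ _)]
  rfl

lemma flip12_right_left (hr : r = ∑ i, x i ⊗ₜ[k] y i) (hm : IsSesquilinear m) (a : P) :
    flip12 (idTensor (cobRight m r) (cobLeft n r a)) = ∑ i, ∑ j, sep (pair23 (x j)) n m
      (op3 k P (-1) (-1) (-1)) (op3 k P (-1) 0 (-1)) a (x i) (y i) (y j) := by
  simp only [idTensor_right_left hr hm, map_sum,
    map_sep flip12 (flip12_op3 _ _ _) (flip12_op3 _ _ _)]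
  rfl

lemma flip12_left_right (hr : r = ∑ i, x i ⊗ₜ[k] y i) (hm : IsSesquilinear m) (a : P) :
    flip12 (idTensor (cobLeft m r) (cobRight n r a)) = ∑ i, ∑ j, nestLeft (slot1 (x i) (y j)) n m
      (op3 k P (-1) (-1) (-1)) (op3 k P (-1) 0 (-1)) a (y i) (x j) := by
  simp only [idTensor_left_right hr hm, map_sum, flip12_nestLeft]
  rfl

lemma flip12_right_right (hr : r = ∑ i, x i ⊗ₜ[k] y i) (hm : IsSesquilinear m) (a : P) :
    flip12 (idTensor (cobRight m r) (cobRight n r a)) = ∑ i, ∑ j, nestLeft (slot3 (x j) (x i)) n m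
      (op3 k P (-1) (-1) (-1)) (op3 k P (-1) 0 (-1)) a (y i) (y j) := by
  simp only [idTensor_right_right hr hm, map_sum, flip12_nestLeft]
  rfl

end Triple

/-! ### The Yang–Baxter terms in a presentation of r -/

section Terms

variable {k P : Type*} [Field k] [AddCommGroup P] [Module k P] {ι : Type*} [Fintype ι]
  {x y : ι → P} {r : P ⊗[k] P}

lemma term1_eq (hr : r = ∑ i, x i ⊗ₜ[k] y i) (m : LambdaMap k P)
    (T : Module.End k (P ⊗[k] (P ⊗[k] P))) :
    term1 m T r = ∑ i, ∑ j, mulAt m T (slot1 (y i) (y j)) (x i) (x j) := by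
  rw [term1, hr]
  simp only [map_sum, LinearMap.sum_apply, TensorProduct.map₂_apply_tmul,
    TensorProduct.map_tmul, TensorProduct.mk_apply]
  rw [Finset.sum_comm]
  refine Finset.sum_congr rfl fun i _ => Finset.sum_congr rfl fun j _ => ?_
  have h : TensorProduct.finsuppLeft k k P (P ⊗[k] P) ℕ (m (x i) (x j) ⊗ₜ (y i ⊗ₜ y j)) =
      coeffMap (slot1 (y i) (y j)) (m (x i) (x j)) := by
    ext l
    simp [coeffMap, TensorProduct.finsuppLeft_apply_tmul_apply]
  rw [h, subst_coeffMap]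
  rfl

lemma term3_eq (hr : r = ∑ i, x i ⊗ₜ[k] y i) (m : LambdaMap k P)
    (T : Module.End k (P ⊗[k] (P ⊗[k] P))) :
    term3 m T r = ∑ i, ∑ j, mulAt m T (slot3 (x i) (x j)) (y i) (y j) := by
  rw [term3, hr]
  simp only [map_sum, LinearMap.sum_apply, TensorProduct.map₂_apply_tmul,
    TensorProduct.map_tmul, TensorProduct.mk_apply]
  rw [Finset.sum_comm]
  refine Finset.sum_congr rfl fun i _ => Finset.sum_congr rfl fun j _ => ?_
  have h : TensorProduct.finsuppRight k k (P ⊗[k] P) P ℕ ((x i ⊗ₜ x j) ⊗ₜ m (y i) (y j)) =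
      coeffMap (TensorProduct.mk k (P ⊗[k] P) P (x i ⊗ₜ x j)) (m (y i) (y j)) := by
    ext l
    simp [coeffMap, TensorProduct.finsuppRight_apply_tmul_apply]
  rw [h, subst_coeffMap]
  rfl

lemma term2_eq (hr : r = ∑ i, x i ⊗ₜ[k] y i) (m : LambdaMap k P)
    (T : Module.End k (P ⊗[k] (P ⊗[k] P))) :
    term2 m T r = ∑ i, ∑ j, mulAt m T (slot2 (x i) (y j)) (x j) (y i) := by
  rw [term2]
  -- Only the outer copy of r is expanded, giving the index i; the copy inside the coefficient map
  -- is expanded in `h` and gives j.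
  nth_rewrite 2 [hr]
  rw [map_sum, map_sum]
  refine Finset.sum_congr rfl fun i _ => ?_
  rw [onRight_tmul, subst_coeffMap]
  have h : ((TensorProduct.finsuppLeft k k P P ℕ).toLinearMap ∘ₗ
      (LinearMap.rTensorHom P ∘ₗ m.flip).flip r) (y i) =
      ∑ j, coeffMap ((TensorProduct.mk k P P).flip (y j)) (m (x j) (y i)) := by
    rw [hr]
    simp only [LinearMap.comp_apply, map_sum, LinearMap.sum_apply]
    refine Finset.sum_congr rfl fun j _ => ?_
    ext l
    simp [coeffMap, TensorProduct.finsuppLeft_apply_tmul_apply]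
  rw [h, map_sum]
  refine Finset.sum_congr rfl fun j _ => ?_
  rw [subst_coeffMap]
  rfl

end Terms

/-! ### Actions of an element on one factor at λ = -∂^{⊗3} -/

section Actions

variable {k P : Type*} [Field k] [AddCommGroup P] [Module k P]
  [Module k[X] P] [IsScalarTower k k[X] P] {ι : Type*} [Fintype ι] {x y : ι → P} {r : P ⊗[k] P}

/-- The action `(n(a)_λ ⊗ I ⊗ I)` at `λ = -∂^{⊗3}`. -/
def act1 (n : LambdaMap k P) (a : P) : Module.End k (P ⊗[k] (P ⊗[k] P)) :=
  subst (op3 k P (-1) (-1) (-1)) LinearMap.id ∘ₗ onLeft (n a)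

/-- The action `(I ⊗ n(a)_λ ⊗ I)` at `λ = -∂^{⊗3}`. -/
def act2 (n : LambdaMap k P) (a : P) : Module.End k (P ⊗[k] (P ⊗[k] P)) :=
  subst (op3 k P (-1) (-1) (-1)) LinearMap.id ∘ₗ onRight (onLeft (n a))

/-- The action `(I ⊗ I ⊗ n(a)_λ)` at `λ = -∂^{⊗3}`. -/
def act3 (n : LambdaMap k P) (a : P) : Module.End k (P ⊗[k] (P ⊗[k] P)) :=
  subst (op3 k P (-1) (-1) (-1)) LinearMap.id ∘ₗ onRight (onRight (n a))

variable {m n : LambdaMap k P}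

lemma act1_tmul (a u v w : P) : act1 n a (u ⊗ₜ (v ⊗ₜ w)) =
    mulAt n (op3 k P (-1) (-1) (-1)) (slot1 v w) a u := by
  rw [act1, LinearMap.comp_apply, onLeft_tmul, subst_coeffMap]
  rfl

lemma act2_tmul (a u v w : P) : act2 n a (u ⊗ₜ (v ⊗ₜ w)) =
    mulAt n (op3 k P (-1) (-1) (-1)) (slot2 u w) a v := by
  rw [act2, LinearMap.comp_apply, onRight_tmul, subst_coeffMap, onLeft_tmul, subst_coeffMap]
  rfl

lemma act3_tmul (a u v w : P) : act3 n a (u ⊗ₜ (v ⊗ₜ w)) =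
    mulAt n (op3 k P (-1) (-1) (-1)) (slot3 u v) a w := by
  rw [act3, LinearMap.comp_apply, onRight_tmul, subst_coeffMap, onRight_tmul, subst_coeffMap]
  rfl

lemma slot1_del (v w p : P) : slot1 (k := k) v w (del k P p) = op3 k P 1 0 0 (slot1 v w p) := by
  simp [op3_tmul]

lemma slot2_del (u w p : P) : slot2 (k := k) u w (del k P p) = op3 k P 0 1 0 (slot2 u w p) := by
  simp [op3_tmul]

lemma slot3_del (u v p : P) : slot3 (k := k) u v (del k P p) = op3 k P 0 0 1 (slot3 u v p) := by
  simp [op3_tmul]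

lemma mulAt_spectator (α β γ α' β' γ' : ℤ) {i j : P →ₗ[k] P ⊗[k] (P ⊗[k] P)}
    (h : ∀ p, i p = op3 k P α β γ (j p)) (a b : P) :
    mulAt n (op3 k P α' β' γ') i a b = op3 k P α β γ (mulAt n (op3 k P α' β' γ') j a b) := by
  rw [map_mulAt n _ (T' := op3 k P α' β' γ') (fun w => LinearMap.congr_fun (op3_commute α β γ α' β' γ').eq w)]
  exact mulAt_congr n rfl h a b

/-- Sesquilinearity replaces the first ∂ by ∂ + λ with λ = -∂^{⊗3}, that is by (0, -1, -1), while
the other two pass through unchanged. The result depends only on differences of coefficients, so (1,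
1, 1) goes to zero. -/
lemma act1_op3 (hn : IsSesquilinear n) (a : P) (α β γ : ℤ) (w : P ⊗[k] (P ⊗[k] P)) :
    act1 n a (op3 k P α β γ w) = op3 k P (α - α) (β - α) (γ - α) (act1 n a w) := by
  have h : act1 n a ∘ₗ op3 k P α β γ = op3 k P (α - α) (β - α) (γ - α) ∘ₗ act1 n a :=
    end_tensor_ext fun u v w => by
      simp only [LinearMap.comp_apply, op3_tmul, map_add, map_zsmul, act1_tmul]
      rw [mulAt_del_right hn (slot1_del v w) (op3_commute _ _ _ _ _ _),
        mulAt_spectator 0 1 0 _ _ _ (i := slot1 (del k P v) w) (j := slot1 v w) (fun p => by simp [op3_tmul]),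
        mulAt_spectator 0 0 1 _ _ _ (i := slot1 v (del k P w))
          (j := slot1 v w) (fun p => by simp [op3_tmul])]
      simp only [op3, combo, LinearMap.add_apply, LinearMap.smul_apply]
      module
  exact LinearMap.congr_fun h w

lemma act2_op3 (hn : IsSesquilinear n) (a : P) (α β γ : ℤ) (w : P ⊗[k] (P ⊗[k] P)) :
    act2 n a (op3 k P α β γ w) = op3 k P (α - β) (β - β) (γ - β) (act2 n a w) := by
  have h : act2 n a ∘ₗ op3 k P α β γ = op3 k P (α - β) (β - β) (γ - β) ∘ₗ act2 n a :=
    end_tensor_ext fun u v w => by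
      simp only [LinearMap.comp_apply, op3_tmul, map_add, map_zsmul, act2_tmul]
      rw [mulAt_del_right hn (slot2_del u w) (op3_commute _ _ _ _ _ _),
        mulAt_spectator 1 0 0 _ _ _ (i := slot2 (del k P u) w) (j := slot2 u w) (fun p => by simp [op3_tmul]),
        mulAt_spectator 0 0 1 _ _ _ (i := slot2 u (del k P w))
          (j := slot2 u w) (fun p => by simp [op3_tmul])]
      simp only [op3, combo, LinearMap.add_apply, LinearMap.smul_apply]
      module
  exact LinearMap.congr_fun h w

lemma act3_op3 (hn : IsSesquilinear n) (a : P) (α β γ : ℤ) (w : P ⊗[k] (P ⊗[k] P)) :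
    act3 n a (op3 k P α β γ w) = op3 k P (α - γ) (β - γ) (γ - γ) (act3 n a w) := by
  have h : act3 n a ∘ₗ op3 k P α β γ = op3 k P (α - γ) (β - γ) (γ - γ) ∘ₗ act3 n a :=
    end_tensor_ext fun u v w => by
      simp only [LinearMap.comp_apply, op3_tmul, map_add, map_zsmul, act3_tmul]
      rw [mulAt_del_right hn (slot3_del u v) (op3_commute _ _ _ _ _ _),
        mulAt_spectator 1 0 0 _ _ _ (i := slot3 (del k P u) v) (j := slot3 u v) (fun p => by simp [op3_tmul]),
        mulAt_spectator 0 1 0 _ _ _ (i := slot3 u (del k P v))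
          (j := slot3 u v) (fun p => by simp [op3_tmul])]
      simp only [op3, combo, LinearMap.add_apply, LinearMap.smul_apply]
      module
  exact LinearMap.congr_fun h w

lemma op3_zero : op3 k P 0 0 0 = 0 := by simp [op3, combo]

lemma act1_eq_zero (hn : IsSesquilinear n) (a : P) {w : P ⊗[k] (P ⊗[k] P)}
    (hw : IsZeroModDel3 w) : act1 n a w = 0 := by
  obtain ⟨z, rfl⟩ := hw
  rw [del3_eq, act1_op3 hn, sub_self, op3_zero, LinearMap.zero_apply]

lemma act2_eq_zero (hn : IsSesquilinear n) (a : P) {w : P ⊗[k] (P ⊗[k] P)}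
    (hw : IsZeroModDel3 w) : act2 n a w = 0 := by
  obtain ⟨z, rfl⟩ := hw
  rw [del3_eq, act2_op3 hn, sub_self, op3_zero, LinearMap.zero_apply]

lemma act3_eq_zero (hn : IsSesquilinear n) (a : P) {w : P ⊗[k] (P ⊗[k] P)}
    (hw : IsZeroModDel3 w) : act3 n a w = 0 := by
  obtain ⟨z, rfl⟩ := hw
  rw [del3_eq, act3_op3 hn, sub_self, op3_zero, LinearMap.zero_apply]

/-- Acting on a product placed in a tensor, when the action is on another factor. -/
lemma map_mulAt_sep (G : Module.End k (P ⊗[k] (P ⊗[k] P))) {T : Module.End k (P ⊗[k] (P ⊗[k] P))}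
    {α β γ α' β' γ' : ℤ} (hG : ∀ w, G (T w) = op3 k P α β γ (G w))
    {i : P →ₗ[k] P ⊗[k] (P ⊗[k] P)} {j : P →ₗ[k] P →ₗ[k] P ⊗[k] (P ⊗[k] P)} {a d : P}
    (h : ∀ q, G (i q) = mulAt n (op3 k P α' β' γ') (j.flip q) a d) (b c : P) :
    G (mulAt m T i b c) = sep j n m (op3 k P α' β' γ') (op3 k P α β γ) a d b c := by
  rw [map_mulAt m G hG, sep_comm (op3_commute _ _ _ _ _ _)]
  exact mulAt_congr m rfl h b c

lemma act1_term1 (hr : r = ∑ i, x i ⊗ₜ[k] y i) (hn : IsSesquilinear n) (a : P) (α β γ : ℤ) :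
    act1 n a (term1 m (op3 k P α β γ) r) = ∑ i, ∑ j, nestRight (slot1 (y i) (y j)) n m
      (op3 k P (-1) (-1) (-1)) (op3 k P (α - α) (β - α) (γ - α)) a (x i) (x j) := by
  simp only [term1_eq hr, map_sum, map_mulAt m _ (act1_op3 hn a _ _ _)]
  exact Finset.sum_congr rfl fun i _ => Finset.sum_congr rfl fun j _ =>
    mulAt_congr m rfl (fun p => act1_tmul a _ _ _) _ _

lemma act2_term2 (hr : r = ∑ i, x i ⊗ₜ[k] y i) (hn : IsSesquilinear n) (a : P) (α β γ : ℤ) :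
    act2 n a (term2 m (op3 k P α β γ) r) = ∑ i, ∑ j, nestRight (slot2 (x i) (y j)) n m
      (op3 k P (-1) (-1) (-1)) (op3 k P (α - β) (β - β) (γ - β)) a (x j) (y i) := by
  simp only [term2_eq hr, map_sum, map_mulAt m _ (act2_op3 hn a _ _ _)]
  exact Finset.sum_congr rfl fun i _ => Finset.sum_congr rfl fun j _ =>
    mulAt_congr m rfl (fun p => act2_tmul a _ _ _) _ _

lemma act3_term3 (hr : r = ∑ i, x i ⊗ₜ[k] y i) (hn : IsSesquilinear n) (a : P) (α β γ : ℤ) :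
    act3 n a (term3 m (op3 k P α β γ) r) = ∑ i, ∑ j, nestRight (slot3 (x i) (x j)) n m
      (op3 k P (-1) (-1) (-1)) (op3 k P (α - γ) (β - γ) (γ - γ)) a (y i) (y j) := by
  simp only [term3_eq hr, map_sum, map_mulAt m _ (act3_op3 hn a _ _ _)]
  exact Finset.sum_congr rfl fun i _ => Finset.sum_congr rfl fun j _ =>
    mulAt_congr m rfl (fun p => act3_tmul a _ _ _) _ _

lemma act2_term1 (hr : r = ∑ i, x i ⊗ₜ[k] y i) (hn : IsSesquilinear n) (a : P) (α β γ : ℤ) :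
    act2 n a (term1 m (op3 k P α β γ) r) = ∑ i, ∑ j, sep (pair12 (y j)).flip n m
      (op3 k P (-1) (-1) (-1)) (op3 k P (α - β) (β - β) (γ - β)) a (y i) (x i) (x j) := by
  simp only [term1_eq hr, map_sum]
  exact Finset.sum_congr rfl fun i _ => Finset.sum_congr rfl fun j _ =>
    map_mulAt_sep _ (i := slot1 (y i) (y j)) (j := (pair12 (y j)).flip)
      (act2_op3 hn a _ _ _) (fun q => act2_tmul a _ _ _) _ _

lemma act3_term1 (hr : r = ∑ i, x i ⊗ₜ[k] y i) (hn : IsSesquilinear n) (a : P) (α β γ : ℤ) :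
    act3 n a (term1 m (op3 k P α β γ) r) = ∑ i, ∑ j, sep (pair13 (y i)).flip n m
      (op3 k P (-1) (-1) (-1)) (op3 k P (α - γ) (β - γ) (γ - γ)) a (y j) (x i) (x j) := by
  simp only [term1_eq hr, map_sum]
  exact Finset.sum_congr rfl fun i _ => Finset.sum_congr rfl fun j _ =>
    map_mulAt_sep _ (i := slot1 (y i) (y j)) (j := (pair13 (y i)).flip)
      (act3_op3 hn a _ _ _) (fun q => act3_tmul a _ _ _) _ _

lemma act1_term2 (hr : r = ∑ i, x i ⊗ₜ[k] y i) (hn : IsSesquilinear n) (a : P) (α β γ : ℤ) :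
    act1 n a (term2 m (op3 k P α β γ) r) = ∑ i, ∑ j, sep (pair12 (y j)) n m
      (op3 k P (-1) (-1) (-1)) (op3 k P (α - α) (β - α) (γ - α)) a (x i) (x j) (y i) := by
  simp only [term2_eq hr, map_sum]
  exact Finset.sum_congr rfl fun i _ => Finset.sum_congr rfl fun j _ =>
    map_mulAt_sep _ (i := slot2 (x i) (y j)) (j := pair12 (y j))
      (act1_op3 hn a _ _ _) (fun q => act1_tmul a _ _ _) _ _

lemma act3_term2 (hr : r = ∑ i, x i ⊗ₜ[k] y i) (hn : IsSesquilinear n) (a : P) (α β γ : ℤ) :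
    act3 n a (term2 m (op3 k P α β γ) r) = ∑ i, ∑ j, sep (pair23 (x i)).flip n m
      (op3 k P (-1) (-1) (-1)) (op3 k P (α - γ) (β - γ) (γ - γ)) a (y j) (x j) (y i) := by
  simp only [term2_eq hr, map_sum]
  exact Finset.sum_congr rfl fun i _ => Finset.sum_congr rfl fun j _ =>
    map_mulAt_sep _ (i := slot2 (x i) (y j)) (j := (pair23 (x i)).flip)
      (act3_op3 hn a _ _ _) (fun q => act3_tmul a _ _ _) _ _

lemma act1_term3 (hr : r = ∑ i, x i ⊗ₜ[k] y i) (hn : IsSesquilinear n) (a : P) (α β γ : ℤ) :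
    act1 n a (term3 m (op3 k P α β γ) r) = ∑ i, ∑ j, sep (pair13 (x j)) n m
      (op3 k P (-1) (-1) (-1)) (op3 k P (α - α) (β - α) (γ - α)) a (x i) (y i) (y j) := by
  simp only [term3_eq hr, map_sum]
  exact Finset.sum_congr rfl fun i _ => Finset.sum_congr rfl fun j _ =>
    map_mulAt_sep _ (i := slot3 (x i) (x j)) (j := pair13 (x j))
      (act1_op3 hn a _ _ _) (fun q => act1_tmul a _ _ _) _ _

lemma act2_term3 (hr : r = ∑ i, x i ⊗ₜ[k] y i) (hn : IsSesquilinear n) (a : P) (α β γ : ℤ) :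
    act2 n a (term3 m (op3 k P α β γ) r) = ∑ i, ∑ j, sep (pair23 (x i)) n m
      (op3 k P (-1) (-1) (-1)) (op3 k P (α - β) (β - β) (γ - β)) a (x j) (y i) (y j) := by
  simp only [term3_eq hr, map_sum]
  exact Finset.sum_congr rfl fun i _ => Finset.sum_congr rfl fun j _ =>
    map_mulAt_sep _ (i := slot3 (x i) (x j)) (j := pair23 (x i))
      (act2_op3 hn a _ _ _) (fun q => act2_tmul a _ _ _) _ _

end Actions

section Negation

variable {k P W : Type*} [Field k] [AddCommGroup P] [Module k P] [AddCommGroup W] [Module k W]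

lemma sep_neg_third {j : P →ₗ[k] P →ₗ[k] W} {S T : Module.End k W}
    (m n : LambdaMap k P) (a b c d : P) : sep j m n S T a b (-c) d = -sep j m n S T a b c d := by
  rw [sep, sep, ← mulAt_neg]
  exact mulAt_congr _ rfl (fun p => by simp) _ _

lemma nestLeft_neg_middle (i : P →ₗ[k] W) (m n : LambdaMap k P) (S T : Module.End k W)
    (a b c : P) : nestLeft i n m S T a (-b) c = -nestLeft i n m S T a b c := by
  simp [nestLeft]

end Negation

/-! ### Axioms rewritten with all products nested on the left -/

section Alternating

variable {k P W : Type*} [Field k] [AddCommGroup P] [Module k P] [AddCommGroup W] [Module k W]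
  [Module k[X] P] [IsScalarTower k k[X] P] {br pr : LambdaMap k P} {S T E : Module.End k W}
  {i : P →ₗ[k] W}

/-- Composites of coboundary maps combine `a` with an entry of r before the second operation, so
their nested terms are left-nested with `a` innermost. This form of Jacobi, and the analogues below,
bring the actions to that shape. -/
lemma jacobi_outer (hP : IsLieConformalAlgebra br) (hi : ∀ p, i (del k P p) = E (i p))
    (hST : Commute S T) (hT : Commute T E) (a b c : P) :
    nestRight i br br S T a b c =
      nestLeft i br br S (S + T) a b c - nestLeft i br br S (-T - E) a c b := by
  have hc : Commute (-T - E) E := (hT.neg_left).sub_left (Commute.refl E)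
  rw [jacobi_at i hP hST, nestLeft_skew_outer (T := -T - E) hP.skew hi hc,
    show -(-T - E) - E = T by abel, sub_neg_eq_add]

lemma assoc_outer (hP : IsAssocConformalAlgebra pr) (hc : IsCommutative pr)
    (hi : ∀ p, i (del k P p) = E (i p))
    (hST : Commute S T) (hT : Commute T E) (a b c : P) :
    nestRight i pr pr S T a b c = nestLeft i pr pr S (-T - E) a c b := by
  rw [nestLeft_comm_outer hc hi ((hT.neg_left).sub_left (Commute.refl E)),
    show -(-T - E) - E = T by abel, mul_left_comm_at i hP hc hST]

lemma leibniz_outer (hP : IsPoissonConformalAlgebra br pr) (hi : ∀ p, i (del k P p) = E (i p))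
    (hST : Commute S T) (hS : Commute S E) (hT : Commute T E) (a b c : P) :
    nestRight i pr br S T a b c =
      nestLeft i pr br S (S + T) a b c - nestLeft i br pr S (-T - E) a c b := by
  rw [leibniz_left_at hP hi hST hS hT,
    nestLeft_comm_outer hP.comm hi ((hT.neg_left).sub_left (Commute.refl E)),
    show -(-T - E) - E = T by abel, add_sub_cancel_right]

/-- `[a_S (b_T c)] = [(a_S c)_{-T-∂} b] + [(a_S b)_{S+T} c]`. -/
lemma leibniz_symm (hP : IsPoissonConformalAlgebra br pr) (hi : ∀ p, i (del k P p) = E (i p))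
    (hST : Commute S T) (hS : Commute S E) (hT : Commute T E) (a b c : P) :
    nestRight i br pr S T a b c =
      nestLeft i pr br S (-T - E) a c b + nestLeft i pr br S (S + T) a b c := by
  have hSU : Commute S (-T - E - S) := ((hST.neg_right).sub_right hS).sub_right (Commute.refl S)
  have hUE : Commute (-T - E - S) E := ((hT.neg_left).sub_left (Commute.refl E)).sub_left hS
  -- Without the operators this is {a, bc} = {ac, b} + {ab, c}: after expansion by Leibniz the terms
  -- a{c, b} and a{b, c} cancel.
  rw [leibniz_at i hP hST, nestLeft_comm_outer hP.comm hi (hS.add_left hT),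
    show -(S + T) - E = -T - E - S by abel, leibniz_left_at hP hi hST hS hT,
    show -T - E = S + (-T - E - S) by abel, leibniz_left_at hP hi hSU hS hUE,
    nestRight_skew hP.assoc.toIsSesquilinear hP.lie.skew hi hSU hS hUE a c b,
    show -(-T - E - S) - (E + S) = T by abel]
  rw [show S + (-T - E - S) - S = -T - E - S by abel]
  abel

end Alternating

/-! ### Matching the actions with the composites of coboundary maps -/

section Matching

variable {k P : Type*} [Field k] [AddCommGroup P] [Module k P]
  [Module k[X] P] [IsScalarTower k k[X] P] {ι : Type*} [Fintype ι] {x y : ι → P} {r : P ⊗[k] P}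
  {br pr n : LambdaMap k P}

lemma sum_sum_swap {M : Type*} [AddCommMonoid M] {f g : ι → ι → M} (h : ∀ i j, f i j = g j i) :
    ∑ i, ∑ j, f i j = ∑ i, ∑ j, g i j := by
  rw [Finset.sum_comm]
  exact Finset.sum_congr rfl fun i _ => Finset.sum_congr rfl fun j _ => h j i

lemma sum_sum_perm {M : Type*} [AddCommMonoid M] {f g : ι → ι → M} (σ : Equiv.Perm ι)
    (h : ∀ i j, f (σ i) j = g i j) : ∑ i, ∑ j, f i j = ∑ i, ∑ j, g i j := by
  rw [← Equiv.sum_comp σ]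
  exact Finset.sum_congr rfl fun i _ => Finset.sum_congr rfl fun j _ => h i j

lemma sum_sum_congr {M : Type*} [AddCommMonoid M] {f g : ι → ι → M} (h : ∀ i j, f i j = g i j) :
    ∑ i, ∑ j, f i j = ∑ i, ∑ j, g i j :=
  Finset.sum_congr rfl fun i _ => Finset.sum_congr rfl fun j _ => h i j

lemma sep_skew3 (hbr : ∀ a b, br a b = -opp br a b) {j : P →ₗ[k] P →ₗ[k] P ⊗[k] (P ⊗[k] P)}
    {S : Module.End k (P ⊗[k] (P ⊗[k] P))} {α β γ α' β' γ' : ℤ}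
    (hj : ∀ p q, j p (del k P q) = op3 k P α' β' γ' (j p q)) (a b c d : P) :
    sep j n br S (op3 k P α β γ) a b c d =
      -sep j n br S (op3 k P (-α - α') (-β - β') (-γ - γ')) a b d c := by
  rw [sep_skew_right hbr n hj (op3_commute _ _ _ _ _ _), op3_neg, op3_sub]

lemma sep_comm3 (hpr : IsCommutative pr) {j : P →ₗ[k] P →ₗ[k] P ⊗[k] (P ⊗[k] P)}
    {S : Module.End k (P ⊗[k] (P ⊗[k] P))} {α β γ α' β' γ' : ℤ}
    (hj : ∀ p q, j p (del k P q) = op3 k P α' β' γ' (j p q)) (a b c d : P) :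
    sep j n pr S (op3 k P α β γ) a b c d =
      sep j n pr S (op3 k P (-α - α') (-β - β') (-γ - γ')) a b d c := by
  rw [sep_comm_right hpr n hj (op3_commute _ _ _ _ _ _), op3_neg, op3_sub]

lemma pair12_del (w p q : P) :
    pair12 (k := k) w p (del k P q) = op3 k P 0 1 0 (pair12 w p q) := by simp [op3_tmul]

lemma pair13_del (v p q : P) :
    pair13 (k := k) v p (del k P q) = op3 k P 0 0 1 (pair13 v p q) := by simp [op3_tmul]

lemma pair13_flip_del (v p q : P) : (pair13 (k := k) v).flip p (del k P q) =
    op3 k P 1 0 0 ((pair13 v).flip p q) := by simp [op3_tmul]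

/-- The action leaves the operator ∂ of the third factor alone; skew-symmetry in the second factor
changes it to (0, -1, -1), the evaluation point of the second coboundary map. -/
lemma act1_term2_skew (hr : r = ∑ i, x i ⊗ₜ[k] y i) (hbr : IsLieConformalAlgebra br)
    (hn : IsSesquilinear n) (a : P) : act1 n a (term2 br (delTrd k P) r) =
      -idTensor (cobLeft br r) (cobLeft n r a) := by
  rw [delTrd_eq, act1_term2 hr hn, idTensor_left_left hr hbr.toIsSesquilinear]
  simp only [← Finset.sum_neg_distrib]
  exact sum_sum_congr fun i j => (sep_skew3 hbr.skew (pair12_del _) _ _ _ _).trans (by norm_num)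

lemma act1_term3_skew (hr : r = ∑ i, x i ⊗ₜ[k] y i) (hbr : IsLieConformalAlgebra br)
    (hn : IsSesquilinear n) (a : P) : act1 n a (term3 br.flip (delSnd k P) r) =
      -idTensor (cobRight br r) (cobLeft n r a) := by
  rw [delSnd_eq, act1_term3 hr hn, idTensor_right_left hr hbr.toIsSesquilinear]
  simp only [← Finset.sum_neg_distrib]
  exact sum_sum_congr fun i j => (sep_skew3 hbr.skew (pair13_del _) _ _ _ _).trans (by norm_num)

lemma act2_term1_skew (hr : r = ∑ i, x i ⊗ₜ[k] y i) (σ : Equiv.Perm ι) (hx : ∀ i, x (σ i) = y i)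
    (hy : ∀ i, y (σ i) = -x i) (hbr : IsSesquilinear br) (hn : IsSesquilinear n) (a : P) :
    act2 n a (term1 br (delSnd k P) r) = -flip12 (idTensor (cobLeft br r) (cobLeft n r a)) := by
  rw [delSnd_eq, act2_term1 hr hn, flip12_left_left hr hbr]
  simp only [← Finset.sum_neg_distrib]
  -- Here the skew-symmetry of r enters: σ exchanges the entries of r at the index i and supplies
  -- the sign.
  refine (sum_sum_perm σ fun i j => ?_).symm
  rw [hx, hy, sep_neg_third, neg_neg]
  norm_num

lemma act2_term3_flip (hr : r = ∑ i, x i ⊗ₜ[k] y i) (hbr : IsSesquilinear br)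
    (hn : IsSesquilinear n) (a : P) : act2 n a (term3 br.flip (delSnd k P) r) =
      flip12 (idTensor (cobRight br r) (cobLeft n r a)) := by
  rw [delSnd_eq, act2_term3 hr hn, flip12_right_left hr hbr]
  exact sum_sum_swap fun i j => rfl

lemma act3_term1_skew (hr : r = ∑ i, x i ⊗ₜ[k] y i) (hbr : IsLieConformalAlgebra br)
    (hn : IsSesquilinear n) (a : P) : act3 n a (term1 br (delSnd k P) r) =
      -tensorId (cobLeft br r) (cobRight n r a) := by
  rw [delSnd_eq, act3_term1 hr hn, tensorId_left_right hr hbr.toIsSesquilinear]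
  simp only [← Finset.sum_neg_distrib]
  exact sum_sum_swap fun i j => (sep_skew3 hbr.skew (pair13_flip_del _) _ _ _ _).trans (by norm_num)

lemma act3_term2_eq (hr : r = ∑ i, x i ⊗ₜ[k] y i) (hbr : IsSesquilinear br)
    (hn : IsSesquilinear n) (a : P) : act3 n a (term2 br (delTrd k P) r) =
      tensorId (cobRight br r) (cobRight n r a) := by
  rw [delTrd_eq, act3_term2 hr hn, tensorId_right_right hr hbr]
  exact sum_sum_swap fun i j => rfl

/-- Skew-symmetry of r moves the entry that meets `a` from y to x, so that the sum is indexed like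
the action on `term1`. -/
lemma flip12_left_right_skew (hr : r = ∑ i, x i ⊗ₜ[k] y i) (σ : Equiv.Perm ι)
    (hx : ∀ i, x (σ i) = y i) (hy : ∀ i, y (σ i) = -x i) (hbr : IsSesquilinear br) (a : P) :
    flip12 (idTensor (cobLeft br r) (cobRight n r a)) =
      -∑ i, ∑ j, nestLeft (slot1 (y i) (y j)) n br
        (op3 k P (-1) (-1) (-1)) (op3 k P (-1) 0 (-1)) a (x i) (x j) := by
  rw [flip12_left_right hr hbr]
  simp only [← Finset.sum_neg_distrib]
  exact sum_sum_perm σ fun i j => by rw [hx, hy, nestLeft_neg_middle]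

lemma act1_term1_jacobi (hr : r = ∑ i, x i ⊗ₜ[k] y i) (σ : Equiv.Perm ι)
    (hx : ∀ i, x (σ i) = y i) (hy : ∀ i, y (σ i) = -x i) (hbr : IsLieConformalAlgebra br) (a : P) :
    act1 br a (term1 br (delSnd k P) r) =
      -flip12 (idTensor (cobLeft br r) (cobRight br r a)) -
        tensorId (cobLeft br r) (cobLeft br r a) := by
  have h := hbr.toIsSesquilinear
  rw [delSnd_eq, act1_term1 hr h, flip12_left_right_skew hr σ hx hy h,
    tensorId_left_left hr h, neg_neg,
    Finset.sum_comm (f := fun i j => nestLeft (slot1 (y j) (y i)) br br _ _ a _ _)]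
  simp only [← Finset.sum_sub_distrib]
  refine sum_sum_congr fun i j => ?_
  rw [jacobi_outer hbr (slot1_del _ _) (op3_commute _ _ _ _ _ _) (op3_commute _ _ _ _ _ _),
    op3_add, op3_neg, op3_sub]
  norm_num

lemma act2_term2_jacobi (hr : r = ∑ i, x i ⊗ₜ[k] y i) (hbr : IsLieConformalAlgebra br) (a : P) :
    act2 br a (term2 br (delTrd k P) r) =
      tensorId (cobRight br r) (cobLeft br r a) - idTensor (cobLeft br r) (cobRight br r a) := by
  have h := hbr.toIsSesquilinear
  rw [delTrd_eq, act2_term2 hr h, tensorId_right_left hr h, idTensor_left_right hr h,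
    Finset.sum_comm (f := fun i j => nestLeft (slot2 (x j) (y i)) br br _ _ a _ _)]
  simp only [← Finset.sum_sub_distrib]
  refine sum_sum_congr fun i j => ?_
  rw [jacobi_outer hbr (slot2_del _ _) (op3_commute _ _ _ _ _ _) (op3_commute _ _ _ _ _ _),
    op3_add, op3_neg, op3_sub]
  norm_num

lemma act3_term3_jacobi (hr : r = ∑ i, x i ⊗ₜ[k] y i) (hbr : IsLieConformalAlgebra br) (a : P) :
    act3 br a (term3 br.flip (delSnd k P) r) =
      flip12 (idTensor (cobRight br r) (cobRight br r a)) -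
        idTensor (cobRight br r) (cobRight br r a) := by
  have h := hbr.toIsSesquilinear
  rw [delSnd_eq, act3_term3 hr h, flip12_right_right hr h, idTensor_right_right hr h,
    Finset.sum_comm (f := fun i j => nestLeft (slot3 (x j) (x i)) br br _ _ a _ _)]
  simp only [← Finset.sum_sub_distrib]
  refine sum_sum_congr fun i j => ?_
  -- The third term of [[r,r]] has its factors in the opposite order; unfolding `br.flip` exposes
  -- the bracket of y j with y i.
  change nestRight (slot3 (x i) (x j)) br br _ _ a (y j) (y i) = _
  rw [jacobi_outer hbr (slot3_del _ _) (op3_commute _ _ _ _ _ _) (op3_commute _ _ _ _ _ _),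
    op3_add, op3_neg, op3_sub]
  norm_num

lemma act1_term1_leibniz (hr : r = ∑ i, x i ⊗ₜ[k] y i) (σ : Equiv.Perm ι)
    (hx : ∀ i, x (σ i) = y i) (hy : ∀ i, y (σ i) = -x i)
    (hP : IsPoissonConformalAlgebra br pr) (a : P) :
    act1 br a (term1 pr (delSnd k P) r) =
      tensorId (cobLeft br r) (cobLeft pr r a) -
        flip12 (idTensor (cobLeft br r) (cobRight pr r a)) := by
  have h := hP.lie.toIsSesquilinear
  rw [delSnd_eq, act1_term1 hr h, flip12_left_right_skew hr σ hx hy h,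
    tensorId_left_left hr h, sub_neg_eq_add,
    Finset.sum_comm (f := fun i j => nestLeft (slot1 (y j) (y i)) pr br _ _ a _ _)]
  simp only [← Finset.sum_add_distrib]
  refine sum_sum_congr fun i j => ?_
  rw [leibniz_symm hP (slot1_del _ _) (op3_commute _ _ _ _ _ _) (op3_commute _ _ _ _ _ _)
    (op3_commute _ _ _ _ _ _), op3_add, op3_neg, op3_sub]
  norm_num

lemma act2_term2_leibniz (hr : r = ∑ i, x i ⊗ₜ[k] y i) (hP : IsPoissonConformalAlgebra br pr)
    (a : P) : act2 pr a (term2 br (delTrd k P) r) =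
      tensorId (cobRight br r) (cobLeft pr r a) - idTensor (cobLeft pr r) (cobRight br r a) := by
  have h := hP.lie.toIsSesquilinear
  have h' := hP.assoc.toIsSesquilinear
  rw [delTrd_eq, act2_term2 hr h', tensorId_right_left hr h, idTensor_left_right hr h',
    Finset.sum_comm (f := fun i j => nestLeft (slot2 (x j) (y i)) pr br _ _ a _ _)]
  simp only [← Finset.sum_sub_distrib]
  refine sum_sum_congr fun i j => ?_
  rw [leibniz_outer hP (slot2_del _ _) (op3_commute _ _ _ _ _ _) (op3_commute _ _ _ _ _ _)
    (op3_commute _ _ _ _ _ _), op3_add, op3_neg, op3_sub]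
  norm_num

lemma act3_term3_leibniz (hr : r = ∑ i, x i ⊗ₜ[k] y i) (hP : IsPoissonConformalAlgebra br pr)
    (a : P) : act3 pr a (term3 br.flip (delSnd k P) r) =
      flip12 (idTensor (cobRight br r) (cobRight pr r a)) -
        idTensor (cobRight pr r) (cobRight br r a) := by
  have h := hP.lie.toIsSesquilinear
  have h' := hP.assoc.toIsSesquilinear
  rw [delSnd_eq, act3_term3 hr h', flip12_right_right hr h, idTensor_right_right hr h',
    Finset.sum_comm (f := fun i j => nestLeft (slot3 (x j) (x i)) pr br _ _ a _ _)]
  simp only [← Finset.sum_sub_distrib]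
  refine sum_sum_congr fun i j => ?_
  change nestRight (slot3 (x i) (x j)) pr br _ _ a (y j) (y i) = _
  rw [leibniz_outer hP (slot3_del _ _) (op3_commute _ _ _ _ _ _) (op3_commute _ _ _ _ _ _)
    (op3_commute _ _ _ _ _ _), op3_add, op3_neg, op3_sub]
  norm_num

lemma neg_delFst_add_delSnd : -(delFst k P + delSnd k P) = op3 k P (-1) (-1) 0 := by
  rw [delFst_eq, delSnd_eq, op3_add, op3_neg]
  norm_num

lemma act1_term3_eq (hr : r = ∑ i, x i ⊗ₜ[k] y i) (hpr : IsSesquilinear pr)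
    (hn : IsSesquilinear n) (a : P) : act1 n a (term3 pr (delFst k P) r) =
      idTensor (cobRight pr r) (cobLeft n r a) := by
  rw [delFst_eq, act1_term3 hr hn, idTensor_right_left hr hpr]
  norm_num

/-- The operator (-1, -1, 0) becomes (0, 0, 1) under the action, and commutativity in the second
factor turns this into (0, -1, -1). -/
lemma act1_term2_comm (hr : r = ∑ i, x i ⊗ₜ[k] y i) (hpr : IsSesquilinear pr)
    (hc : IsCommutative pr) (hn : IsSesquilinear n) (a : P) :
    act1 n a (term2 pr (-(delFst k P + delSnd k P)) r) =
      idTensor (cobLeft pr r) (cobLeft n r a) := by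
  rw [neg_delFst_add_delSnd, act1_term2 hr hn, idTensor_left_left hr hpr]
  exact sum_sum_congr fun i j => (sep_comm3 hc (pair12_del _) _ _ _ _).trans (by norm_num)

lemma act3_term1_comm (hr : r = ∑ i, x i ⊗ₜ[k] y i) (hpr : IsSesquilinear pr)
    (hc : IsCommutative pr) (hn : IsSesquilinear n) (a : P) :
    act3 n a (term1 pr (delSnd k P) r) = tensorId (cobLeft pr r) (cobRight n r a) := by
  rw [delSnd_eq, act3_term1 hr hn, tensorId_left_right hr hpr]
  exact sum_sum_swap fun i j => (sep_comm3 hc (pair13_flip_del _) _ _ _ _).trans (by norm_num)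

lemma act3_term2_swap (hr : r = ∑ i, x i ⊗ₜ[k] y i) (hpr : IsSesquilinear pr)
    (hn : IsSesquilinear n) (a : P) :
    act3 n a (term2 pr (-(delFst k P + delSnd k P)) r) =
      tensorId (cobRight pr r) (cobRight n r a) := by
  rw [neg_delFst_add_delSnd, act3_term2 hr hn, tensorId_right_right hr hpr]
  exact sum_sum_swap fun i j => rfl

lemma act1_term1_assoc (hr : r = ∑ i, x i ⊗ₜ[k] y i) (hpr : IsAssocConformalAlgebra pr)
    (hc : IsCommutative pr) (a : P) : act1 pr a (term1 pr (delSnd k P) r) =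
      tensorId (cobLeft pr r) (cobLeft pr r a) := by
  have h := hpr.toIsSesquilinear
  rw [delSnd_eq, act1_term1 hr h, tensorId_left_left hr h]
  refine sum_sum_swap fun i j => ?_
  rw [assoc_outer hpr hc (slot1_del _ _) (op3_commute _ _ _ _ _ _) (op3_commute _ _ _ _ _ _),
    op3_neg, op3_sub]
  norm_num

lemma act3_term3_assoc (hr : r = ∑ i, x i ⊗ₜ[k] y i) (hpr : IsAssocConformalAlgebra pr) (a : P) :
    act3 pr a (term3 pr (delFst k P) r) = idTensor (cobRight pr r) (cobRight pr r a) := by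
  have h := hpr.toIsSesquilinear
  rw [delFst_eq, act3_term3 hr h, idTensor_right_right hr h]
  refine sum_sum_congr fun i j => ?_
  rw [← assoc_at _ hpr (op3_commute _ _ _ _ _ _), op3_add]
  norm_num

/-- The middle-factor terms of the two sides of coassociativity agree outright, so coassociativity
needs no action on the second factor. -/
lemma idTensor_left_right_eq (hr : r = ∑ i, x i ⊗ₜ[k] y i) (hpr : IsAssocConformalAlgebra pr)
    (hc : IsCommutative pr) (a : P) : idTensor (cobLeft pr r) (cobRight pr r a) =
      tensorId (cobRight pr r) (cobLeft pr r a) := by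
  have h := hpr.toIsSesquilinear
  rw [idTensor_left_right hr h, tensorId_right_left hr h]
  refine sum_sum_swap fun i j => ?_
  -- With S = -∂^{⊗3}, the choice of ∂ on the first factor for T makes S + T = (0, -1, -1) and -T -
  -- E = (-1, -1, 0), the two evaluation points to be compared.
  have h1 := assoc_at (slot2 (x i) (y j)) hpr
    (op3_commute (k := k) (P := P) (-1) (-1) (-1) 1 0 0) a (y i) (x j)
  rw [assoc_outer hpr hc (slot2_del _ _) (op3_commute _ _ _ _ _ _) (op3_commute _ _ _ _ _ _),
    op3_add, op3_neg, op3_sub] at h1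
  norm_num at h1
  exact h1

end Matching

section TensorMaps

variable {k P : Type*} [Field k] [AddCommGroup P] [Module k P]

lemma idTensor_add (D D' : P →ₗ[k] P ⊗[k] P) (w : P ⊗[k] P) :
    idTensor (D + D') w = idTensor D w + idTensor D' w := by
  simp [idTensor, LinearMap.lTensor_add]

lemma idTensor_sub (D D' : P →ₗ[k] P ⊗[k] P) (w : P ⊗[k] P) :
    idTensor (D - D') w = idTensor D w - idTensor D' w := by
  simp [idTensor, LinearMap.lTensor_sub]

lemma tensorId_add (D D' : P →ₗ[k] P ⊗[k] P) (w : P ⊗[k] P) :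
    tensorId (D + D') w = tensorId D w + tensorId D' w := by
  simp [tensorId, LinearMap.rTensor_add]

lemma tensorId_sub (D D' : P →ₗ[k] P ⊗[k] P) (w : P ⊗[k] P) :
    tensorId (D - D') w = tensorId D w - tensorId D' w := by
  simp [tensorId, LinearMap.rTensor_sub]

end TensorMaps

/-! ### Coalgebra axioms from the Yang–Baxter equation -/

section Coalgebra

variable {k P : Type*} [Field k] [AddCommGroup P] [Module k P]
  [Module k[X] P] [IsScalarTower k k[X] P] {br pr : LambdaMap k P} {r : P ⊗[k] P}

lemma cobDelta_apply (br : LambdaMap k P) (r : P ⊗[k] P) (a : P) :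
    cobDelta br r a = cobLeft br r a + cobRight br r a := rfl

lemma cobCoprod_apply (pr : LambdaMap k P) (r : P ⊗[k] P) (a : P) :
    cobCoprod pr r a = cobRight pr r a - cobLeft pr r a := rfl

lemma cobDelta_del (hbr : IsSesquilinear br) : IsDelHom (cobDelta br r) := fun a => by
  simp only [cobDelta_apply, cobLeft_del hbr r a, cobRight_del hbr r a, map_add]

lemma cobCoprod_del (hpr : IsSesquilinear pr) : IsDelHom (cobCoprod pr r) := fun a => by
  simp only [cobCoprod_apply, cobLeft_del hpr r a, cobRight_del hpr r a, map_sub]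

lemma cobDelta_skew (hskew : flip r = -r) (a : P) :
    cobDelta br r a = -flip (cobDelta br r a) := by
  rw [cobDelta_apply, map_add, flip_cobLeft, flip_cobRight, hskew, cobLeft_neg, cobRight_neg]
  abel

lemma cobCoprod_cocomm (hskew : flip r = -r) : IsCocommutative (cobCoprod pr r) := fun a => by
  rw [cobCoprod_apply, map_sub, flip_cobLeft, flip_cobRight, hskew, cobLeft_neg, cobRight_neg]
  abel

theorem cobDelta_isLieConformalCoalgebra [CharZero k] (hbr : IsLieConformalAlgebra br)
    (hskew : flip r = -r) (hr : IsZeroModDel3 (doubleBracket br r)) :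
    IsLieConformalCoalgebra (cobDelta br r) := by
  refine ⟨cobDelta_del hbr.toIsSesquilinear, cobDelta_skew hskew, fun a => ?_⟩
  obtain ⟨ι, _, σ, x, y, hxy, hx, hy⟩ := exists_skew_presentation r hskew
  have h := hbr.toIsSesquilinear
  have h1 := act1_eq_zero h a hr
  have h2 := act2_eq_zero h a hr
  have h3 := act3_eq_zero h a hr
  rw [doubleBracket, map_sub, map_sub] at h1 h2 h3
  rw [act1_term1_jacobi hxy σ hx hy hbr, act1_term2_skew hxy hbr h,
    act1_term3_skew hxy hbr h] at h1
  rw [act2_term1_skew hxy σ hx hy h h, act2_term2_jacobi hxy hbr, act2_term3_flip hxy h h] at h2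
  rw [act3_term1_skew hxy hbr h, act3_term2_eq hxy h h, act3_term3_jacobi hxy hbr] at h3
  -- The sum of the three actions on [[r,r]] is exactly the co-Jacobi defect.
  have h0 := congrArg₂ (· + ·) (congrArg₂ (· + ·) h1 h2) h3
  simp only [add_zero] at h0
  rw [← sub_eq_zero]
  rw [← h0, cobDelta_apply, cobDelta]
  simp only [idTensor_add, tensorId_add, map_add]
  abel

theorem cobCoprod_isAssocConformalCoalgebra [CharZero k] (hpr : IsAssocConformalAlgebra pr)
    (hc : IsCommutative pr) (hskew : flip r = -r) (hr : IsZeroModDel3 (bullet pr r)) :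
    IsAssocConformalCoalgebra (cobCoprod pr r) := by
  refine ⟨cobCoprod_del hpr.toIsSesquilinear, fun a => ?_⟩
  obtain ⟨ι, _, σ, x, y, hxy, hx, hy⟩ := exists_skew_presentation r hskew
  have h := hpr.toIsSesquilinear
  have h1 := act1_eq_zero h a hr
  have h3 := act3_eq_zero h a hr
  rw [bullet, map_add, map_sub] at h1 h3
  rw [act1_term1_assoc hxy hpr hc, act1_term2_comm hxy h hc h, act1_term3_eq hxy h h] at h1
  rw [act3_term1_comm hxy h hc h, act3_term2_swap hxy h h, act3_term3_assoc hxy hpr] at h3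
  -- This difference is the coassociativity defect, up to the middle-factor terms that
  -- `idTensor_left_right_eq` cancels.
  have h0 := congrArg₂ (· - ·) h3 h1
  simp only [sub_zero] at h0
  rw [← sub_eq_zero]
  rw [← h0, cobCoprod_apply, cobCoprod]
  simp only [idTensor_sub, tensorId_sub, map_sub, idTensor_left_right_eq hxy hpr hc]
  abel

theorem cob_isPoissonConformalCoalgebra [CharZero k] (hP : IsPoissonConformalAlgebra br pr)
    (hskew : flip r = -r) (hr : IsPCYBESolution br pr r) :
    IsPoissonConformalCoalgebra (cobDelta br r) (cobCoprod pr r) := by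
  refine ⟨cobDelta_isLieConformalCoalgebra hP.lie hskew hr.bracket,
    cobCoprod_isAssocConformalCoalgebra hP.assoc hP.comm hskew hr.product,
    cobCoprod_cocomm hskew, fun a => ?_⟩
  obtain ⟨ι, _, σ, x, y, hxy, hx, hy⟩ := exists_skew_presentation r hskew
  have h := hP.lie.toIsSesquilinear
  have h' := hP.assoc.toIsSesquilinear
  have h1 := act1_eq_zero h a hr.product
  have h2 := act2_eq_zero h' a hr.bracket
  have h3 := act3_eq_zero h' a hr.bracket
  rw [bullet, map_add, map_sub, act1_term1_leibniz hxy σ hx hy hP,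
    act1_term2_comm hxy h' hP.comm h, act1_term3_eq hxy h' h] at h1
  rw [doubleBracket, map_sub, map_sub] at h2 h3
  rw [act2_term1_skew hxy σ hx hy h h', act2_term2_leibniz hxy hP, act2_term3_flip hxy h h'] at h2
  rw [act3_term1_skew hxy hP.lie h', act3_term2_eq hxy h h', act3_term3_leibniz hxy hP] at h3
  -- The bracket acts on r • r and the product on [[r,r]]; with these signs the total is the defect
  -- of the compatibility between δ and Δ.
  have h0 := congrArg₂ (· + ·) (congrArg₂ (· - ·) h1 h2) h3
  simp only [add_zero, sub_zero] at h0
  rw [← sub_eq_zero]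
  rw [← h0, cobCoprod_apply, cobDelta_apply, cobCoprod, cobDelta]
  simp only [idTensor_sub, idTensor_add, tensorId_add, map_sub, map_add]
  abel

end Coalgebra

section Substituted

variable {k V W : Type*} [Field k] [AddCommGroup V] [Module k V] [AddCommGroup W] [Module k W]

lemma coeffMap_const (f : V →ₗ[k] W) (v : V) :
    coeffMap f (const (k := k) v) = const (k := k) (f v) := by
  simp [coeffMap, const]

lemma coeffMap_var (f : V →ₗ[k] W) (g : LPoly V) :
    coeffMap f (var (k := k) g) = var (k := k) (coeffMap f g) := by
  induction g using Finsupp.induction_linear with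
  | zero => simp
  | add f g hf hg => simp only [map_add, hf, hg]
  | single n v => simp [coeffMap, var, Finsupp.mapDomain_single]

lemma coeffMap_coeffMap {X : Type*} [AddCommGroup X] [Module k X] (f : W →ₗ[k] X) (h : V →ₗ[k] W)
    (g : LPoly V) : coeffMap f (coeffMap h g) = coeffMap (f ∘ₗ h) g := by
  ext n
  simp [coeffMap]

lemma coeffMap_eq_subst (f : V →ₗ[k] W) (g : LPoly V) :
    coeffMap f g = subst (var (k := k)) (const ∘ₗ f) g := by
  rw [← subst_coeffMap, subst_var_const]

end Substituted

/-! ### Calculus in (P ⊗ P)[λ] with the operators `op2` -/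

section Double

variable {k P : Type*} [Field k] [AddCommGroup P] [Module k P]

/-- The placement `p ↦ p ⊗ v`. -/
def slotLeft (v : P) : P →ₗ[k] LPoly (P ⊗[k] P) := const ∘ₗ (TensorProduct.mk k P P).flip v

/-- The placement `p ↦ u ⊗ p`. -/
def slotRight (u : P) : P →ₗ[k] LPoly (P ⊗[k] P) := const ∘ₗ TensorProduct.mk k P P u

variable (k P) in
/-- The placement `(p, q) ↦ p ⊗ q`. -/
def pairBoth : P →ₗ[k] P →ₗ[k] LPoly (P ⊗[k] P) := (TensorProduct.mk k P P).compr₂ const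

/-- `(f_T ⊗ I)` applied to a tensor, in `(P ⊗ P)[λ]`. -/
def leftAt (T : Module.End k (LPoly (P ⊗[k] P))) (f : P →ₗ[k] LPoly P) :
    P ⊗[k] P →ₗ[k] LPoly (P ⊗[k] P) := subst T const ∘ₗ onLeft f

/-- `(I ⊗ f_T)` applied to a tensor, in `(P ⊗ P)[λ]`. -/
def rightAt (T : Module.End k (LPoly (P ⊗[k] P))) (f : P →ₗ[k] LPoly P) :
    P ⊗[k] P →ₗ[k] LPoly (P ⊗[k] P) := subst T const ∘ₗ onRight f

lemma leftAt_tmul (n : LambdaMap k P) (T : Module.End k (LPoly (P ⊗[k] P))) (a u v : P) :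
    leftAt T (n a) (u ⊗ₜ v) = mulAt n T (slotLeft v) a u := by
  rw [leftAt, LinearMap.comp_apply, onLeft_tmul, subst_coeffMap]
  rfl

lemma rightAt_tmul (n : LambdaMap k P) (T : Module.End k (LPoly (P ⊗[k] P))) (a u v : P) :
    rightAt T (n a) (u ⊗ₜ v) = mulAt n T (slotRight u) a v := by
  rw [rightAt, LinearMap.comp_apply, onRight_tmul, subst_coeffMap]
  rfl

lemma coeffMap_flip_onLeft (f : P →ₗ[k] LPoly P) (w : P ⊗[k] P) :
    coeffMap flip (onLeft f w) = onRight f (flip w) := by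
  induction w with
  | zero => simp
  | add u v hu hv => simp only [map_add, hu, hv]
  | tmul u v =>
    change _ = onRight f (v ⊗ₜ u)
    rw [onLeft_tmul, onRight_tmul, coeffMap_coeffMap]
    rfl

lemma coeffMap_flip_onRight (f : P →ₗ[k] LPoly P) (w : P ⊗[k] P) :
    coeffMap flip (onRight f w) = onLeft f (flip w) := by
  induction w with
  | zero => simp
  | add u v hu hv => simp only [map_add, hu, hv]
  | tmul u v =>
    change _ = onLeft f (v ⊗ₜ u)
    rw [onLeft_tmul, onRight_tmul, coeffMap_coeffMap]
    rfl

variable [Module k[X] P] [IsScalarTower k k[X] P]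

variable (k P) in
/-- The operator `α λ + β ∂ ⊗ I + γ I ⊗ ∂` on `(P ⊗ P)[λ]`. -/
def op2 (α β γ : ℤ) : Module.End k (LPoly (P ⊗[k] P)) :=
  combo var (coeffMap ((del k P).rTensor P)) (coeffMap ((del k P).lTensor P)) α β γ

lemma op2_commute (α β γ α' β' γ' : ℤ) : Commute (op2 k P α β γ) (op2 k P α' β' γ') := by
  refine combo_commute ?_ ?_ ?_ _ _ _ _ _ _
  · exact LinearMap.ext fun w => (coeffMap_var _ w).symm
  · exact LinearMap.ext fun w => (coeffMap_var _ w).symm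
  · refine LinearMap.ext fun w => ?_
    rw [Module.End.mul_apply, Module.End.mul_apply, coeffMap_coeffMap, coeffMap_coeffMap]
    congr 2
    ext u v
    rfl

lemma op2_add (α β γ α' β' γ' : ℤ) :
    op2 k P α β γ + op2 k P α' β' γ' = op2 k P (α + α') (β + β') (γ + γ') := by
  simp only [op2, combo]; module

lemma var_eq : var = op2 k P 1 0 0 := by simp [op2, combo]

lemma negVarDel2_eq : negVarDel2 = op2 k P (-1) (-1) (-1) := by
  refine LinearMap.ext fun w => ?_
  have h : coeffMap (del2 k P) w = coeffMap ((del k P).rTensor P) w +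
      coeffMap ((del k P).lTensor P) w := by
    ext n
    simp [coeffMap, del2]
  simp only [negVarDel2, op2, combo, LinearMap.sub_apply, LinearMap.neg_apply, h,
    LinearMap.add_apply, LinearMap.smul_apply]
  module

lemma const_del2 (w : P ⊗[k] P) :
    const (k := k) (-del2 k P w) = op2 k P 0 (-1) (-1) (const (k := k) w) := by
  simp only [op2, combo, LinearMap.add_apply, LinearMap.smul_apply, coeffMap_const, del2,
    map_neg, map_add]
  module

lemma slotLeft_del (v p : P) :
    slotLeft (k := k) v (del k P p) = op2 k P 0 1 0 (slotLeft v p) := by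
  simp [slotLeft, op2, combo, coeffMap_const]

lemma slotRight_del (u p : P) :
    slotRight (k := k) u (del k P p) = op2 k P 0 0 1 (slotRight u p) := by
  simp [slotRight, op2, combo, coeffMap_const]

variable {n : LambdaMap k P}

lemma mulAt_spectator2 (α β γ α' β' γ' : ℤ) {i j : P →ₗ[k] LPoly (P ⊗[k] P)}
    (h : ∀ p, i p = op2 k P α β γ (j p)) (a b : P) :
    mulAt n (op2 k P α' β' γ') i a b = op2 k P α β γ (mulAt n (op2 k P α' β' γ') j a b) := by
  rw [map_mulAt n _ (T' := op2 k P α' β' γ')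
    (fun w => LinearMap.congr_fun (op2_commute α β γ α' β' γ').eq w)]
  exact mulAt_congr n rfl h a b

/-- Acting at T turns ∂^{⊗2} into ∂^{⊗2} + T, so -∂^{⊗2} becomes -T - ∂^{⊗2}. This involution
exchanges λ and ν, which puts `a` at λ and `b` at ν whichever of them acts last. -/
lemma leftAt_del2 (hn : IsSesquilinear n) (a : P) (α β γ : ℤ) (w : P ⊗[k] P) :
    leftAt (op2 k P α β γ) (n a) (-del2 k P w) =
      op2 k P (-α) (-1 - β) (-1 - γ) (leftAt (op2 k P α β γ) (n a) w) := by
  induction w with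
  | zero => simp
  | add u v hu hv => simp only [map_add, neg_add, hu, hv]
  | tmul u v =>
    rw [del2_tmul, map_neg, map_add, leftAt_tmul, leftAt_tmul, leftAt_tmul,
      mulAt_del_right hn (slotLeft_del v) (op2_commute _ _ _ _ _ _),
      mulAt_spectator2 0 0 1 _ _ _ (i := slotLeft (del k P v)) (j := slotLeft v)
        (fun p => by simp [slotLeft, op2, combo, coeffMap_const])]
    simp only [op2, combo, LinearMap.add_apply, LinearMap.smul_apply]
    module

lemma rightAt_del2 (hn : IsSesquilinear n) (a : P) (α β γ : ℤ) (w : P ⊗[k] P) :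
    rightAt (op2 k P α β γ) (n a) (-del2 k P w) =
      op2 k P (-α) (-1 - β) (-1 - γ) (rightAt (op2 k P α β γ) (n a) w) := by
  induction w with
  | zero => simp
  | add u v hu hv => simp only [map_add, neg_add, hu, hv]
  | tmul u v =>
    rw [del2_tmul, map_neg, map_add, rightAt_tmul, rightAt_tmul, rightAt_tmul,
      mulAt_del_right hn (slotRight_del u) (op2_commute _ _ _ _ _ _),
      mulAt_spectator2 0 1 0 _ _ _ (i := slotRight (del k P u)) (j := slotRight u)
        (fun p => by simp [slotRight, op2, combo, coeffMap_const])]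
    simp only [op2, combo, LinearMap.add_apply, LinearMap.smul_apply]
    module

variable {ι : Type*} [Fintype ι] {x y : ι → P} {r : P ⊗[k] P} {m : LambdaMap k P}

lemma leftAt_cobLeft (hr : r = ∑ i, x i ⊗ₜ[k] y i) (hn : IsSesquilinear n) (a b : P)
    (α β γ : ℤ) : leftAt (op2 k P α β γ) (n a) (cobLeft m r b) = ∑ i, nestRight (slotLeft (y i))
      n m (op2 k P α β γ) (op2 k P (-α) (-1 - β) (-1 - γ)) a b (x i) := by
  rw [map_cobLeft hr m _ (leftAt_del2 hn a α β γ)]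
  exact Finset.sum_congr rfl fun i _ => mulAt_congr m rfl (fun p => leftAt_tmul n _ a p (y i)) _ _

lemma rightAt_cobRight (hr : r = ∑ i, x i ⊗ₜ[k] y i) (hn : IsSesquilinear n) (a b : P)
    (α β γ : ℤ) : rightAt (op2 k P α β γ) (n a) (cobRight m r b) =
      ∑ i, nestRight (slotRight (x i))
        n m (op2 k P α β γ) (op2 k P (-α) (-1 - β) (-1 - γ)) a b (y i) := by
  rw [map_cobRight hr m _ (rightAt_del2 hn a α β γ)]
  exact Finset.sum_congr rfl fun i _ => mulAt_congr m rfl (fun p => rightAt_tmul n _ a (x i) p) _ _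

lemma leftAt_cobRight (hr : r = ∑ i, x i ⊗ₜ[k] y i) (hn : IsSesquilinear n) (a b : P)
    (α β γ : ℤ) : leftAt (op2 k P α β γ) (n a) (cobRight m r b) = ∑ i, sep (pairBoth k P)
      n m (op2 k P α β γ) (op2 k P (-α) (-1 - β) (-1 - γ)) a (x i) b (y i) := by
  rw [map_cobRight hr m _ (leftAt_del2 hn a α β γ)]
  refine Finset.sum_congr rfl fun i _ => ?_
  rw [sep_comm (op2_commute _ _ _ _ _ _)]
  exact mulAt_congr m rfl (fun p => leftAt_tmul n _ a (x i) p) _ _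

lemma rightAt_cobLeft (hr : r = ∑ i, x i ⊗ₜ[k] y i) (hn : IsSesquilinear n) (a b : P)
    (α β γ : ℤ) : rightAt (op2 k P α β γ) (n a) (cobLeft m r b) = ∑ i, sep (pairBoth k P)
      m n (op2 k P (-α) (-1 - β) (-1 - γ)) (op2 k P α β γ) b (x i) a (y i) := by
  rw [map_cobLeft hr m _ (rightAt_del2 hn a α β γ)]
  exact Finset.sum_congr rfl fun i _ => mulAt_congr m rfl (fun p => rightAt_tmul n _ a p (y i)) _ _

lemma coeffMap_cobLeft (hr : r = ∑ i, x i ⊗ₜ[k] y i) (a b : P) :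
    coeffMap (cobLeft m r) (n a b) = ∑ i, nestLeft (slotLeft (y i)) n m (op2 k P 1 0 0)
      (op2 k P 0 (-1) (-1)) a b (x i) := by
  rw [coeffMap_eq_subst, var_eq]
  exact mulAt_eq_sum n _ (fun p => map_cobLeft hr m const const_del2 p) a b

lemma coeffMap_cobRight (hr : r = ∑ i, x i ⊗ₜ[k] y i) (a b : P) :
    coeffMap (cobRight m r) (n a b) = ∑ i, nestLeft (slotRight (x i)) n m (op2 k P 1 0 0)
      (op2 k P 0 (-1) (-1)) a b (y i) := by
  rw [coeffMap_eq_subst, var_eq]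
  exact mulAt_eq_sum n _ (fun p => map_cobRight hr m const const_del2 p) a b

lemma onLeft_eq (f : P →ₗ[k] LPoly P) (w : P ⊗[k] P) :
    onLeft f w = leftAt (op2 k P 1 0 0) f w := by
  rw [← var_eq, leftAt, LinearMap.comp_apply, subst_var_const]

lemma onRight_eq (f : P →ₗ[k] LPoly P) (w : P ⊗[k] P) :
    onRight f w = rightAt (op2 k P 1 0 0) f w := by
  rw [← var_eq, rightAt, LinearMap.comp_apply, subst_var_const]

lemma leftTw_eq (f : P →ₗ[k] LPoly P) (w : P ⊗[k] P) :
    leftTw f w = leftAt (op2 k P (-1) (-1) (-1)) f w := by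
  rw [← negVarDel2_eq]; rfl

lemma rightTw_eq (f : P →ₗ[k] LPoly P) (w : P ⊗[k] P) :
    rightTw f w = rightAt (op2 k P (-1) (-1) (-1)) f w := by
  rw [← negVarDel2_eq]; rfl

/-- Both sides are the sum of `a` at λ against x i in the first factor and `b` at ν against y i in
the second; operations in different factors commute. -/
lemma onLeft_cobRight (hr : r = ∑ i, x i ⊗ₜ[k] y i) (hn : IsSesquilinear n)
    (hm : IsSesquilinear m) (a b : P) :
    onLeft (n a) (cobRight m r b) = rightTw (m b) (cobLeft n r a) := by
  rw [onLeft_eq, rightTw_eq, leftAt_cobRight hr hn, rightAt_cobLeft hr hm]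
  norm_num

lemma onRight_cobLeft (hr : r = ∑ i, x i ⊗ₜ[k] y i) (hn : IsSesquilinear n)
    (hm : IsSesquilinear m) (a b : P) :
    onRight (n a) (cobLeft m r b) = leftTw (m b) (cobRight n r a) := by
  rw [onRight_eq, leftTw_eq, rightAt_cobLeft hr hn, leftAt_cobRight hr hm]
  norm_num

lemma onLeft_cobLeft (hr : r = ∑ i, x i ⊗ₜ[k] y i) (hn : IsSesquilinear n) (a b : P) :
    onLeft (n a) (cobLeft m r b) = ∑ i, nestRight (slotLeft (y i))
      n m (op2 k P 1 0 0) (op2 k P (-1) (-1) (-1)) a b (x i) := by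
  rw [onLeft_eq, leftAt_cobLeft hr hn]
  norm_num

lemma onRight_cobRight (hr : r = ∑ i, x i ⊗ₜ[k] y i) (hn : IsSesquilinear n) (a b : P) :
    onRight (n a) (cobRight m r b) = ∑ i, nestRight (slotRight (x i))
      n m (op2 k P 1 0 0) (op2 k P (-1) (-1) (-1)) a b (y i) := by
  rw [onRight_eq, rightAt_cobRight hr hn]
  norm_num

lemma leftTw_cobLeft (hr : r = ∑ i, x i ⊗ₜ[k] y i) (hn : IsSesquilinear n) (a b : P) :
    leftTw (n a) (cobLeft m r b) = ∑ i, nestRight (slotLeft (y i))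
      n m (op2 k P (-1) (-1) (-1)) (op2 k P 1 0 0) a b (x i) := by
  rw [leftTw_eq, leftAt_cobLeft hr hn]
  norm_num

lemma rightTw_cobRight (hr : r = ∑ i, x i ⊗ₜ[k] y i) (hn : IsSesquilinear n) (a b : P) :
    rightTw (n a) (cobRight m r b) = ∑ i, nestRight (slotRight (x i))
      n m (op2 k P (-1) (-1) (-1)) (op2 k P 1 0 0) a b (y i) := by
  rw [rightTw_eq, rightAt_cobRight hr hn]
  norm_num

lemma op2_var_add : op2 k P 1 0 0 + op2 k P (-1) (-1) (-1) = op2 k P 0 (-1) (-1) := by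
  rw [op2_add]
  norm_num

end Double

/-! ### Bialgebra compatibilities -/

section Compatibility

variable {k P : Type*} [Field k] [AddCommGroup P] [Module k P]
  [Module k[X] P] [IsScalarTower k k[X] P] {br pr : LambdaMap k P}
  {ι : Type*} [Fintype ι] {x y : ι → P} {r : P ⊗[k] P}

/-- `[a_S (b_T c)] + [b_T (a_S c)] = [(a_S b)_{S+T} c]`. -/
lemma leibniz_sum {W : Type*} [AddCommGroup W] [Module k W] (i : P →ₗ[k] W)
    {S T : Module.End k W} (hP : IsPoissonConformalAlgebra br pr)
    {E : Module.End k W} (hi : ∀ p, i (del k P p) = E (i p)) (h : Commute S T)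
    (hS : Commute S E) (hT : Commute T E) (a b c : P) :
    nestLeft i pr br S (S + T) a b c =
      nestRight i br pr S T a b c + nestRight i br pr T S b a c := by
  rw [leibniz_at i hP h, leibniz_at i hP h.symm, leibniz_left_at hP hi h hS hT,
    nestLeft_skew hP.assoc.toIsSesquilinear hP.lie.skew ((Commute.refl S).add_right h),
    add_sub_cancel_left, add_comm T S]
  abel

/-- This is Jacobi at S = λ and T = ν applied to each entry of r, because S + T = -∂^{⊗2} is where
the coboundary is evaluated. -/
lemma coeffMap_cobLeft_bracket (hr : r = ∑ i, x i ⊗ₜ[k] y i) (hbr : IsLieConformalAlgebra br)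
    (a b : P) : coeffMap (cobLeft br r) (br a b) =
      onLeft (br a) (cobLeft br r b) - leftTw (br b) (cobLeft br r a) := by
  have h := hbr.toIsSesquilinear
  rw [coeffMap_cobLeft hr, onLeft_cobLeft hr h, leftTw_cobLeft hr h, ← Finset.sum_sub_distrib]
  refine Finset.sum_congr rfl fun i _ => ?_
  rw [jacobi_at _ hbr (op2_commute _ _ _ _ _ _), op2_var_add, add_sub_cancel_right]

lemma coeffMap_cobRight_bracket (hr : r = ∑ i, x i ⊗ₜ[k] y i) (hbr : IsLieConformalAlgebra br)
    (a b : P) : coeffMap (cobRight br r) (br a b) =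
      onRight (br a) (cobRight br r b) - rightTw (br b) (cobRight br r a) := by
  have h := hbr.toIsSesquilinear
  rw [coeffMap_cobRight hr, onRight_cobRight hr h, rightTw_cobRight hr h,
    ← Finset.sum_sub_distrib]
  refine Finset.sum_congr rfl fun i _ => ?_
  rw [jacobi_at _ hbr (op2_commute _ _ _ _ _ _), op2_var_add, add_sub_cancel_right]

lemma coeffMap_cobLeft_leibniz (hr : r = ∑ i, x i ⊗ₜ[k] y i)
    (hP : IsPoissonConformalAlgebra br pr) (a b : P) : coeffMap (cobLeft pr r) (br a b) =
      onLeft (br a) (cobLeft pr r b) - leftTw (pr b) (cobLeft br r a) := by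
  rw [coeffMap_cobLeft hr, onLeft_cobLeft hr hP.lie.toIsSesquilinear,
    leftTw_cobLeft hr hP.assoc.toIsSesquilinear, ← Finset.sum_sub_distrib]
  refine Finset.sum_congr rfl fun i _ => ?_
  rw [leibniz_at _ hP (op2_commute _ _ _ _ _ _), op2_var_add, add_sub_cancel_right]

lemma coeffMap_cobRight_leibniz (hr : r = ∑ i, x i ⊗ₜ[k] y i)
    (hP : IsPoissonConformalAlgebra br pr) (a b : P) : coeffMap (cobRight pr r) (br a b) =
      onRight (br a) (cobRight pr r b) - rightTw (pr b) (cobRight br r a) := by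
  rw [coeffMap_cobRight hr, onRight_cobRight hr hP.lie.toIsSesquilinear,
    rightTw_cobRight hr hP.assoc.toIsSesquilinear, ← Finset.sum_sub_distrib]
  refine Finset.sum_congr rfl fun i _ => ?_
  rw [leibniz_at _ hP (op2_commute _ _ _ _ _ _), op2_var_add, add_sub_cancel_right]

lemma coeffMap_cobLeft_mul (hr : r = ∑ i, x i ⊗ₜ[k] y i)
    (hP : IsPoissonConformalAlgebra br pr) (a b : P) : coeffMap (cobLeft br r) (pr a b) =
      onLeft (pr a) (cobLeft br r b) + leftTw (pr b) (cobLeft br r a) := by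
  have h := hP.assoc.toIsSesquilinear
  rw [coeffMap_cobLeft hr, onLeft_cobLeft hr h, leftTw_cobLeft hr h, ← Finset.sum_add_distrib]
  refine Finset.sum_congr rfl fun i _ => ?_
  rw [← op2_var_add, leibniz_left_at hP (slotLeft_del _) (op2_commute _ _ _ _ _ _)
    (op2_commute _ _ _ _ _ _) (op2_commute _ _ _ _ _ _)]

/-- The right half must produce terms of Δ acted on by brackets, so Leibniz is used as {ab, c} = {a,
bc} + {b, ac}; the left half uses {ab, c} = a{b, c} + b{a, c}. -/
lemma coeffMap_cobRight_mul (hr : r = ∑ i, x i ⊗ₜ[k] y i)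
    (hP : IsPoissonConformalAlgebra br pr) (a b : P) : coeffMap (cobRight br r) (pr a b) =
      onRight (br a) (cobRight pr r b) + rightTw (br b) (cobRight pr r a) := by
  have h := hP.lie.toIsSesquilinear
  rw [coeffMap_cobRight hr, onRight_cobRight hr h, rightTw_cobRight hr h,
    ← Finset.sum_add_distrib]
  refine Finset.sum_congr rfl fun i _ => ?_
  rw [← op2_var_add, leibniz_sum _ hP (slotRight_del _) (op2_commute _ _ _ _ _ _)
    (op2_commute _ _ _ _ _ _) (op2_commute _ _ _ _ _ _)]

lemma coeffMap_cobRight_assoc (hr : r = ∑ i, x i ⊗ₜ[k] y i) (hpr : IsAssocConformalAlgebra pr)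
    (a b : P) : coeffMap (cobRight pr r) (pr a b) = onRight (pr a) (cobRight pr r b) := by
  rw [coeffMap_cobRight hr, onRight_cobRight hr hpr.toIsSesquilinear]
  refine Finset.sum_congr rfl fun i _ => ?_
  rw [← op2_var_add, assoc_at _ hpr (op2_commute _ _ _ _ _ _)]

lemma onLeft_cobLeft_comm (hr : r = ∑ i, x i ⊗ₜ[k] y i) (hpr : IsAssocConformalAlgebra pr)
    (hc : IsCommutative pr) (a b : P) :
    onLeft (pr a) (cobLeft pr r b) = leftTw (pr b) (cobLeft pr r a) := by
  rw [onLeft_cobLeft hr hpr.toIsSesquilinear, leftTw_cobLeft hr hpr.toIsSesquilinear]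
  exact Finset.sum_congr rfl fun i _ => mul_left_comm_at _ hpr hc (op2_commute _ _ _ _ _ _) _ _ _

lemma onRight_cobRight_comm (hr : r = ∑ i, x i ⊗ₜ[k] y i) (hpr : IsAssocConformalAlgebra pr)
    (hc : IsCommutative pr) (a b : P) :
    onRight (pr a) (cobRight pr r b) = rightTw (pr b) (cobRight pr r a) := by
  rw [onRight_cobRight hr hpr.toIsSesquilinear, rightTw_cobRight hr hpr.toIsSesquilinear]
  exact Finset.sum_congr rfl fun i _ => mul_left_comm_at _ hpr hc (op2_commute _ _ _ _ _ _) _ _ _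

lemma coeffMap_cobLeft_assoc (hr : r = ∑ i, x i ⊗ₜ[k] y i) (hpr : IsAssocConformalAlgebra pr)
    (hc : IsCommutative pr) (a b : P) :
    coeffMap (cobLeft pr r) (pr a b) = leftTw (pr b) (cobLeft pr r a) := by
  rw [← onLeft_cobLeft_comm hr hpr hc, coeffMap_cobLeft hr,
    onLeft_cobLeft hr hpr.toIsSesquilinear]
  refine Finset.sum_congr rfl fun i _ => ?_
  rw [← op2_var_add, assoc_at _ hpr (op2_commute _ _ _ _ _ _)]

lemma coeffMap_cobDelta (br : LambdaMap k P) (r : P ⊗[k] P) (f : LPoly P) :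
    coeffMap (cobDelta br r) f = coeffMap (cobLeft br r) f + coeffMap (cobRight br r) f := by
  ext n
  simp [coeffMap, cobDelta_apply]

lemma coeffMap_cobCoprod (pr : LambdaMap k P) (r : P ⊗[k] P) (f : LPoly P) :
    coeffMap (cobCoprod pr r) f = coeffMap (cobRight pr r) f - coeffMap (cobLeft pr r) f := by
  ext n
  simp [coeffMap, cobCoprod_apply]

theorem cobDelta_isLieConformalBialgebra (hbr : IsLieConformalAlgebra br)
    (hco : IsLieConformalCoalgebra (cobDelta br r)) (hr : r = ∑ i, x i ⊗ₜ[k] y i) :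
    IsLieConformalBialgebra br (cobDelta br r) := by
  refine ⟨hbr, hco, fun a b => ?_⟩
  have h := hbr.toIsSesquilinear
  rw [coeffMap_cobDelta, coeffMap_cobLeft_bracket hr hbr, coeffMap_cobRight_bracket hr hbr]
  simp only [cobDelta_apply, map_add, onLeft_cobRight hr h h, onRight_cobLeft hr h h]
  abel

theorem cobCoprod_isASIConformalBialgebra (hpr : IsAssocConformalAlgebra pr)
    (hc : IsCommutative pr) (hco : IsAssocConformalCoalgebra (cobCoprod pr r))
    (hskew : flip r = -r) (hr : r = ∑ i, x i ⊗ₜ[k] y i) :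
    IsASIConformalBialgebra pr (cobCoprod pr r) := by
  have h := hpr.toIsSesquilinear
  have hopp : opp pr = pr := LinearMap.ext fun a => LinearMap.ext fun b => (hc a b).symm
  refine ⟨hpr, hco, fun a b => ?_, fun a b => ?_⟩
  · rw [hopp, coeffMap_cobCoprod, coeffMap_cobRight_assoc hr hpr,
      coeffMap_cobLeft_assoc hr hpr hc]
    simp only [cobCoprod_apply, map_sub, onRight_cobLeft hr h h]
    abel
  -- The flip moves the action to the other factor and fixes the coproduct, as r is skew. The eight
  -- terms then cancel in pairs: mixed ones by the exchange of λ and ν, the others because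
  -- multiplications by `a` and `b` commute.
  · rw [hopp, map_sub (coeffMap flip), coeffMap_flip_onLeft, coeffMap_flip_onRight]
    simp only [cobCoprod_apply, map_sub, flip_cobLeft, flip_cobRight, hskew, cobLeft_neg,
      cobRight_neg, map_neg, onRight_cobLeft hr h h, onLeft_cobRight hr h h,
      onLeft_cobLeft_comm hr hpr hc a b, onRight_cobRight_comm hr hpr hc a b]
    abel

theorem cob_isPoissonConformalBialgebra (hP : IsPoissonConformalAlgebra br pr)
    (hco : IsPoissonConformalCoalgebra (cobDelta br r) (cobCoprod pr r))
    (hskew : flip r = -r) (hr : r = ∑ i, x i ⊗ₜ[k] y i) :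
    IsPoissonConformalBialgebra br pr (cobDelta br r) (cobCoprod pr r) := by
  have h := hP.lie.toIsSesquilinear
  have h' := hP.assoc.toIsSesquilinear
  refine ⟨hP, hco, cobDelta_isLieConformalBialgebra hP.lie hco.lie hr,
    cobCoprod_isASIConformalBialgebra hP.assoc hP.comm hco.assoc hskew hr, hP.comm, hco.cocomm,
    fun a b => ?_, fun a b => ?_⟩
  · rw [coeffMap_cobDelta, coeffMap_cobLeft_mul hr hP, coeffMap_cobRight_mul hr hP]
    simp only [cobDelta_apply, cobCoprod_apply, map_add, map_sub, onLeft_cobRight hr h' h,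
      onRight_cobLeft hr h h']
    abel
  · rw [coeffMap_cobCoprod, coeffMap_cobLeft_leibniz hr hP, coeffMap_cobRight_leibniz hr hP]
    simp only [cobDelta_apply, cobCoprod_apply, map_add, map_sub, onLeft_cobRight hr h h',
      onRight_cobLeft hr h h']
    abel

end Compatibility

end

end PoissonConformal

theorem corollary3p11 {k P : Type*} [Field k] [CharZero k] [AddCommGroup P] [Module k P]
    [Module k[X] P] [IsScalarTower k k[X] P]
    (br pr : PoissonConformal.LambdaMap k P)
    (hP : PoissonConformal.IsPoissonConformalAlgebra br pr)
    (r : P ⊗[k] P)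
    (hskew : PoissonConformal.flip r = -r)
    (hr : PoissonConformal.IsPCYBESolution br pr r) :
    PoissonConformal.IsPoissonConformalCoalgebra
        (PoissonConformal.cobDelta br r) (PoissonConformal.cobCoprod pr r) ∧
      PoissonConformal.IsPoissonConformalBialgebra br pr
        (PoissonConformal.cobDelta br r) (PoissonConformal.cobCoprod pr r) := by
  have hco := PoissonConformal.cob_isPoissonConformalCoalgebra hP hskew hr
  obtain ⟨ι, _, σ, x, y, hxy, -, -⟩ := PoissonConformal.exists_skew_presentation r hskew
  exact ⟨hco, PoissonConformal.cob_isPoissonConformalBialgebra hP hco hskew hxy⟩
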